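/- Let $V,W$ be real Banach spaces, and let $A$ be the generator of a $C_0$-semigroup $(S_t)_{t\ge 0}$ on $W$. Equip $D(A)$ and $D(A^2)=\{y\in D(A):Ay\in D(A)\}$ with the graph norms $|y|+|Ay|$ and $|y|+|Ay|+|A^2y|$. Let $\alpha\in(\frac13,\frac12]$ and $0<T_0\le T$, and write $X_{s,t}:=X_t-X_s$; $V\otimes V$ denotes the completed projective tensor product, so that every element of $L(V,L(V,W))$ acts on $V\otimes V$. **Rough and controlled paths.** Let $\mathbf X=(X,\mathbb X)$ be an $\alpha$-Hölder rough path on $[0,T]$ over $V$: $X:[0,T]\to V$ is $\alpha$-Hölder, $\mathbb X:[0,T]^2\to V\otimes V$ satisfies $|\mathbb X_{s,t}|\le C|t-s|^{2\alpha}$, and $\mathbb X_{s,t}-\mathbb X_{s,u}-\mathbb X_{u,t}=X_{s,u}\otimes X_{u,t}$ for all $s,u,t\in[0,T]$. For a Banach space $E$, $(Y,Y')\in\mathscr D_X^{2\alpha}([0,T_0],E)$ means that $Y:[0,T_0]\to E$ and $Y':[0,T_0]\to L(V,E)$ are $\alpha$-Hölder and $|Y_t-Y_s-Y'_sX_{s,t}|\le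 C|t-s|^{2\alpha}$ for all $s,t\in[0,T_0]$. For a controlled path $(Z,Z')$ with values in $E=L(V,W)$ the rough integral is $$\int_a^b Z_r\,d\mathbf X_r:=\lim_{|\Pi|\to0}\sum_{[s,t]\in\Pi}\bigl(Z_sX_{s,t}+Z'_s\mathbb X_{s,t}\bigr)\in W,$$ the limit being over partitions $\Pi$ of $[a,b]$ whose mesh tends to $0$. **Coefficients.** Let $f_0\in\mathrm{Lip}([0,T]\times W,D(A))$, that is, $f_0:[0,T]\times W\to D(A)$ is continuous and Lipschitz in $y$ uniformly in $t$. Let $f\in C_b^{2\alpha,2}([0,T]\times W,L(V,D(A^2)))$, that is: each $f(t,\cdot)$ is twice continuously Fréchet differentiable, $f,D_yf,D_y^2f$ are bounded on $[0,T]\times W$, and $f,D_yf$ are $2\alpha$-Hölder in $t$, uniformly in $y$. For a controlled path $(Y,Y')$ the Gubinelli derivative of $f(Y)_t:=f(t,Y_t)$ is $f(Y)'_t:=D_yf(t,Y_t)Y'_t$, and that of $s\mapsto S_{t-s}f(s,Y_s)$ is $s\mapsto S_{t-s}f(Y)'_s$. **Claim.** Let $\xi\in D(A)$, and let $(Y,Y')\in\mathscr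 D_X^{2\alpha}([0,T_0],W)$ be a local mild solution with $Y_0=\xi$, that is, $Y'_t=f(t,Y_t)$ and $$Y_t=S_t\xi+\int_0^tS_{t-s}f_0(s,Y_s)\,ds+\int_0^tS_{t-s}f(s,Y_s)\,d\mathbf X_s,\qquad t\in[0,T_0]$$ (every such $Y$ is $D(A)$-valued). Suppose that the path $AY:[0,T_0]\to W$ is bounded. Then $(Y,Y')$ is a local strong solution with $Y_0=\xi$: $Y$ is $D(A)$-valued, $AY$ is bounded, $Y'_t=f(t,Y_t)$, and for every $t\in[0,T_0]$ the integrals below exist and $$Y_t=\xi+\int_0^t\bigl(AY_s+f_0(s,Y_s)\bigr)\,ds+\int_0^tf(s,Y_s)\,d\mathbf X_s .$$ -/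

import Mathlib

open Set Filter Topology MeasureTheory
open scoped TensorProduct

noncomputable section

namespace RoughPDE

/-! ### The projective tensor product `V ⊗ V` -/

section Tensor

variable (V : Type*) [NormedAddCommGroup V] [NormedSpace ℝ V]

/-- The Banach space `V ⊗ V`: the completion of the algebraic tensor product with respect to the
projective norm (the norm that Mathlib puts on `PiTensorProduct`). -/
abbrev ProjTensor : Type _ := UniformSpace.Completion (⨂[ℝ] _ : Fin 2, V)

variable {V} {W : Type*} [NormedAddCommGroup W] [NormedSpace ℝ W]

/-- The elementary tensor `v ⊗ w`. -/
def tmul (v w : V) : ProjTensor V := ((PiTensorProduct.tprod ℝ ![v, w] : ⨂[ℝ] _ : Fin 2, V) :)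

/-- An element of `L(V, L(V, W))` as a continuous multilinear map of two variables. -/
def biMulti (B : V →L[ℝ] V →L[ℝ] W) : ContinuousMultilinearMap ℝ (fun _ : Fin 2 => V) W :=
  MultilinearMap.mkContinuous
    { toFun := fun m => B (m 0) (m 1)
      map_update_add' := by
        intro _ m i x y
        fin_cases i <;> simp [Function.update]
      map_update_smul' := by
        intro _ m i c x
        fin_cases i <;> simp [Function.update] }
    ‖B‖ (by
      intro m
      simpa [Fin.prod_univ_two, mul_assoc] using B.le_opNorm₂ (m 0) (m 1))

/-- The embedding `L(V, L(V, W)) ↪ L(V ⊗ V, W)`. -/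
def tensorLift [CompleteSpace W] (B : V →L[ℝ] V →L[ℝ] W) : ProjTensor V →L[ℝ] W :=
  (PiTensorProduct.liftIsometry ℝ (fun _ : Fin 2 => V) W (biMulti B)).extend
    (UniformSpace.Completion.toComplL (𝕜 := ℝ) (E := ⨂[ℝ] _ : Fin 2, V))

theorem tensorLift_tmul [CompleteSpace W] (B : V →L[ℝ] V →L[ℝ] W) (v w : V) :
    tensorLift B (tmul v w) = B v w := by
  have h := ContinuousLinearMap.extend_eq
    (PiTensorProduct.liftIsometry ℝ (fun _ : Fin 2 => V) W (biMulti B))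
    (e := UniformSpace.Completion.toComplL (𝕜 := ℝ) (E := ⨂[ℝ] _ : Fin 2, V))
    (UniformSpace.Completion.denseRange_coe)
    (UniformSpace.Completion.isUniformInducing_coe _)
    (PiTensorProduct.tprod ℝ ![v, w])
  refine Eq.trans h ?_
  simp [biMulti]

end Tensor

/-! ### Strongly continuous semigroups and their generators -/

section Semigroup

variable {W : Type*} [NormedAddCommGroup W] [NormedSpace ℝ W]

/-- A strongly continuous semigroup on `W`. Only the operators `S t` with `0 ≤ t` matter. -/
structure C0Semigroup (W : Type*) [NormedAddCommGroup W] [NormedSpace ℝ W] where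
  op : ℝ → W →L[ℝ] W
  op_zero : op 0 = ContinuousLinearMap.id ℝ W
  op_add : ∀ s t : ℝ, 0 ≤ s → 0 ≤ t → op (s + t) = (op s).comp (op t)
  tendsto_op : ∀ y : W, Tendsto (fun t => op t y) (𝓝[≥] 0) (𝓝 y)

/-- `z = lim_{h ↓ 0} (S_h y - y) / h`. -/
def C0Semigroup.HasGen (S : C0Semigroup W) (y z : W) : Prop :=
  Tendsto (fun h : ℝ => h⁻¹ • (S.op h y - y)) (𝓝[>] 0) (𝓝 z)

/-- `A y = lim_{h ↓ 0} (S_h y - y) / h`, meaningful for `y` in the domain `D(A)`. -/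
def C0Semigroup.gen (S : C0Semigroup W) (y : W) : W :=
  haveI : Nonempty W := ⟨0⟩
  limUnder (𝓝[>] (0 : ℝ)) (fun h : ℝ => h⁻¹ • (S.op h y - y))

theorem C0Semigroup.HasGen.gen_eq {S : C0Semigroup W} {y z : W} (h : S.HasGen y z) :
    S.gen y = z :=
  Tendsto.limUnder_eq h

theorem C0Semigroup.HasGen.add {S : C0Semigroup W} {y z y' z' : W} (h : S.HasGen y z)
    (h' : S.HasGen y' z') : S.HasGen (y + y') (z + z') := by
  refine (Tendsto.add h h').congr fun r => ?_
  rw [← smul_add, map_add]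
  congr 1
  abel

theorem C0Semigroup.HasGen.smul {S : C0Semigroup W} {y z : W} (c : ℝ) (h : S.HasGen y z) :
    S.HasGen (c • y) (c • z) := by
  refine (Tendsto.const_smul h c).congr fun r => ?_
  rw [smul_comm, map_smul, smul_sub]

theorem C0Semigroup.HasGen.zero {S : C0Semigroup W} : S.HasGen 0 0 := by
  simp [C0Semigroup.HasGen]

/-- The infinitesimal generator `A : W ⊃ D(A) → W`, where `D(A)` consists of all `y` for which the
limit of `(S_h y - y) / h` as `h ↓ 0` exists. -/
def C0Semigroup.generator (S : C0Semigroup W) : W →ₗ.[ℝ] W where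
  domain :=
    { carrier := {y | ∃ z, S.HasGen y z}
      add_mem' := fun ⟨z, hz⟩ ⟨z', hz'⟩ => ⟨z + z', hz.add hz'⟩
      zero_mem' := ⟨0, C0Semigroup.HasGen.zero⟩
      smul_mem' := fun c _ ⟨z, hz⟩ => ⟨c • z, hz.smul c⟩ }
  toFun :=
    { toFun := fun y => S.gen y
      map_add' := by
        rintro ⟨y, z, hz⟩ ⟨y', z', hz'⟩
        change S.gen (y + y') = S.gen y + S.gen y'
        rw [(hz.add hz').gen_eq, hz.gen_eq, hz'.gen_eq]
      map_smul' := by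
        rintro c ⟨y, z, hz⟩
        change S.gen (c • y) = c • S.gen y
        rw [(hz.smul c).gen_eq, hz.gen_eq] }

end Semigroup

/-! ### The domains `D(A)` and `D(A²)` with their graph norms -/

section Domains

variable {W : Type*} [NormedAddCommGroup W] [NormedSpace ℝ W]

/-- `D(A)` as a type of its own, to be normed by `|y| + |A y|`. -/
def Dom (A : W →ₗ.[ℝ] W) : Type _ := A.domain

/-- `D(A²) = {y ∈ D(A) : A y ∈ D(A)}` as a type of its own, to be normed by
`|y| + |A y| + |A² y|`. -/
def Dom2 (A : W →ₗ.[ℝ] W) : Type _ := A.domain.comap A.toFun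

variable (A : W →ₗ.[ℝ] W)

instance : AddCommGroup (Dom A) := inferInstanceAs (AddCommGroup A.domain)
instance : Module ℝ (Dom A) := inferInstanceAs (Module ℝ A.domain)
instance : AddCommGroup (Dom2 A) := inferInstanceAs (AddCommGroup (A.domain.comap A.toFun))
instance : Module ℝ (Dom2 A) := inferInstanceAs (Module ℝ (A.domain.comap A.toFun))

/-- The inclusion `D(A) → W`. -/
def Dom.val : Dom A →ₗ[ℝ] W := A.domain.subtype

/-- `A : D(A) → W`. -/
def Dom.app : Dom A →ₗ[ℝ] W := A.toFun

/-- The inclusion `D(A²) → D(A)`. -/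
def Dom2.toDom : Dom2 A →ₗ[ℝ] Dom A := (A.domain.comap A.toFun).subtype

/-- `A : D(A²) → D(A)`. -/
def Dom2.app : Dom2 A →ₗ[ℝ] Dom A :=
  (A.toFun ∘ₗ (A.domain.comap A.toFun).subtype).codRestrict A.domain fun y => y.2

instance : NormedAddCommGroup (Dom A) :=
  AddGroupNorm.toNormedAddCommGroup
    { toFun := fun y => ‖Dom.val A y‖ + ‖Dom.app A y‖
      map_zero' := by simp
      add_le' := fun x y => by
        rw [map_add, map_add]
        linarith [norm_add_le (Dom.val A x) (Dom.val A y), norm_add_le (Dom.app A x) (Dom.app A y)]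
      neg' := fun x => by simp
      eq_zero_of_map_eq_zero' := fun x hx => by
        have h : ‖Dom.val A x‖ = 0 :=
          le_antisymm (by linarith [norm_nonneg (Dom.app A x)]) (norm_nonneg _)
        exact Subtype.ext (norm_eq_zero.1 h) }

theorem Dom.norm_def (y : Dom A) : ‖y‖ = ‖Dom.val A y‖ + ‖Dom.app A y‖ := rfl

instance : NormedSpace ℝ (Dom A) where
  norm_smul_le c y := by simp [Dom.norm_def, norm_smul, mul_add]

instance : NormedAddCommGroup (Dom2 A) :=
  AddGroupNorm.toNormedAddCommGroup
    { toFun := fun y => ‖Dom.val A (Dom2.toDom A y)‖ + ‖Dom.app A (Dom2.toDom A y)‖ +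
        ‖Dom.app A (Dom2.app A y)‖
      map_zero' := by simp
      add_le' := fun x y => by
        simp only [map_add]
        linarith [norm_add_le (Dom.val A (Dom2.toDom A x)) (Dom.val A (Dom2.toDom A y)),
          norm_add_le (Dom.app A (Dom2.toDom A x)) (Dom.app A (Dom2.toDom A y)),
          norm_add_le (Dom.app A (Dom2.app A x)) (Dom.app A (Dom2.app A y))]
      neg' := fun x => by simp
      eq_zero_of_map_eq_zero' := fun x hx => by
        have h : ‖Dom.val A (Dom2.toDom A x)‖ = 0 :=
          by
          linarith [norm_nonneg (Dom.val A (Dom2.toDom A x)),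
            norm_nonneg (Dom.app A (Dom2.toDom A x)), norm_nonneg (Dom.app A (Dom2.app A x))]
        exact Subtype.ext (Subtype.ext (norm_eq_zero.1 h)) }

theorem Dom2.norm_def (y : Dom2 A) :
    ‖y‖ = ‖Dom.val A (Dom2.toDom A y)‖ + ‖Dom.app A (Dom2.toDom A y)‖ +
      ‖Dom.app A (Dom2.app A y)‖ := rfl

instance : NormedSpace ℝ (Dom2 A) where
  norm_smul_le c y := by simp [Dom2.norm_def, norm_smul, mul_add]

/-- The continuous inclusion `D(A) → W`. -/
def Dom.incl : Dom A →L[ℝ] W :=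
  (Dom.val A).mkContinuous 1 fun y => by
    rw [Dom.norm_def]; linarith [norm_nonneg (Dom.app A y)]

/-- The continuous inclusion `D(A²) → W`. -/
def Dom2.incl : Dom2 A →L[ℝ] W :=
  (Dom.val A ∘ₗ Dom2.toDom A).mkContinuous 1 fun y => by
    rw [Dom2.norm_def, LinearMap.comp_apply]
    linarith [norm_nonneg (Dom.app A (Dom2.toDom A y)), norm_nonneg (Dom.app A (Dom2.app A y))]

end Domains

/-! ### Function spaces -/

section Spaces

variable {V W E : Type*} [NormedAddCommGroup V] [NormedSpace ℝ V] [NormedAddCommGroup W]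
  [NormedSpace ℝ W] [NormedAddCommGroup E] [NormedSpace ℝ E]

/-- `Z ∈ 𝒞^γ([0,T], E)`: the path `Z` is `γ`-Hölder continuous on `[0,T]`. -/
def IsHolder (γ T : ℝ) (Z : ℝ → E) : Prop :=
  ∃ C : ℝ, ∀ s ∈ Icc 0 T, ∀ t ∈ Icc 0 T, ‖Z t - Z s‖ ≤ C * |t - s| ^ γ

/-- `f₀ ∈ Lip([0,T] × W, E)`: jointly continuous, and Lipschitz in the space variable uniformly
in time. -/
def IsLip (T : ℝ) (f₀ : ℝ → W → E) : Prop :=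
  ContinuousOn (fun p : ℝ × W => f₀ p.1 p.2) (Icc 0 T ×ˢ univ) ∧
    ∃ L : ℝ, 0 < L ∧ ∀ t ∈ Icc 0 T, ∀ y z : W, ‖f₀ t y - f₀ t z‖ ≤ L * ‖y - z‖

/-- `f ∈ C_b^{γ,n}([0,T] × W, E)`: every `f(t,·)` is `n` times continuously Fréchet differentiable,
the derivatives of order `0, …, n` are bounded uniformly in `t` and `y`, and those of order
`0, …, n - 1` are `γ`-Hölder continuous in `t`, uniformly in `y`. -/
structure IsCb (γ : ℝ) (n : ℕ) (T : ℝ) (f : ℝ → W → E) : Prop where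
  contDiff : ∀ t ∈ Icc 0 T, ContDiff ℝ n (f t)
  bounded : ∃ C : ℝ, ∀ k ≤ n, ∀ t ∈ Icc 0 T, ∀ y : W, ‖iteratedFDeriv ℝ k (f t) y‖ ≤ C
  holder : ∃ C : ℝ, ∀ k < n, ∀ y : W, ∀ s ∈ Icc 0 T, ∀ t ∈ Icc 0 T,
    ‖iteratedFDeriv ℝ k (f t) y - iteratedFDeriv ℝ k (f s) y‖ ≤ C * |t - s| ^ γ

/-- `(X, 𝕏) ∈ 𝒞^α([0,T], V)`: an `α`-Hölder rough path. -/
structure IsRoughPath (α T : ℝ) (X : ℝ → V) (XX : ℝ → ℝ → ProjTensor V) : Prop where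
  holder : IsHolder α T X
  holder₂ : ∃ C : ℝ, ∀ s ∈ Icc 0 T, ∀ t ∈ Icc 0 T, ‖XX s t‖ ≤ C * |t - s| ^ (2 * α)
  chen : ∀ s ∈ Icc 0 T, ∀ u ∈ Icc 0 T, ∀ t ∈ Icc 0 T,
    XX s t - XX s u - XX u t = tmul (X u - X s) (X t - X u)

/-- `(Y, Y') ∈ 𝒟_X^{2α}([0,T], E)`: a path controlled by `X` with Gubinelli derivative `Y'`. -/
structure IsControlled (α T : ℝ) (X : ℝ → V) (Y : ℝ → E) (Y' : ℝ → V →L[ℝ] E) : Prop where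
  holder : IsHolder α T Y
  holder_deriv : IsHolder α T Y'
  remainder : ∃ C : ℝ, ∀ s ∈ Icc 0 T, ∀ t ∈ Icc 0 T,
    ‖Y t - Y s - Y' s (X t - X s)‖ ≤ C * |t - s| ^ (2 * α)

end Spaces

/-! ### The rough integral -/

section Integral

variable {V W : Type*} [NormedAddCommGroup V] [NormedSpace ℝ V] [NormedAddCommGroup W]
  [NormedSpace ℝ W] [CompleteSpace W]

/-- The rough integral of `(Z, Z')` against `(X, 𝕏)` over `[a,b]` exists and equals `I`: the
compensated Riemann sums `∑ (Z_s X_{s,t} + Z'_s 𝕏_{s,t})` over partitions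
`a = π 0 ≤ ⋯ ≤ π n = b` tend to `I` as the mesh of the partition tends to zero. -/
def HasRoughIntegral (X : ℝ → V) (XX : ℝ → ℝ → ProjTensor V)
    (Z : ℝ → V →L[ℝ] W) (Z' : ℝ → V →L[ℝ] V →L[ℝ] W) (a b : ℝ) (I : W) : Prop :=
  ∀ ε > 0, ∃ δ > 0, ∀ (n : ℕ) (π : ℕ → ℝ), Monotone π → π 0 = a → π n = b →
    (∀ i < n, π (i + 1) - π i < δ) →
    ‖∑ i ∈ Finset.range n, (Z (π i) (X (π (i + 1)) - X (π i)) +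
      tensorLift (Z' (π i)) (XX (π i) (π (i + 1)))) - I‖ < ε

open Classical in
/-- The value of the rough integral of `(Z, Z')` against `(X, 𝕏)` over `[a,b]` (and `0` if the
limit does not exist, which never happens for controlled rough paths). -/
def roughIntegral (X : ℝ → V) (XX : ℝ → ℝ → ProjTensor V)
    (Z : ℝ → V →L[ℝ] W) (Z' : ℝ → V →L[ℝ] V →L[ℝ] W) (a b : ℝ) : W :=
  if h : ∃ I, HasRoughIntegral X XX Z Z' a b I then h.choose else 0

end Integral

/-! ### Solution concepts -/

section Solutions

variable {V W : Type*} [NormedAddCommGroup V] [NormedSpace ℝ V] [NormedAddCommGroup W]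
  [NormedSpace ℝ W] [CompleteSpace W]

/-- `f(Y)'_t = D_y f(t, Y_t) Y'_t`, the Gubinelli derivative of `f(Y)`. -/
def compDeriv {E : Type*} [NormedAddCommGroup E] [NormedSpace ℝ E] (f : ℝ → W → E)
    (Y : ℝ → W) (Y' : ℝ → V →L[ℝ] W) (t : ℝ) : V →L[ℝ] E :=
  (fderiv ℝ (f t) (Y t)).comp (Y' t)

/-- A local strong solution `(Y, Y')` on `[0,T₀]` of
`dY = (A Y + f₀(t, Y)) dt + f(t, Y) d𝐗`, `Y_0 = ξ`, where `A` is the generator of `S`.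
It is part of the definition that both integrals exist. -/
structure IsLocalStrongSolution (S : C0Semigroup W) (α T₀ : ℝ) (X : ℝ → V)
    (XX : ℝ → ℝ → ProjTensor V) (f₀ : ℝ → W → W) (f : ℝ → W → V →L[ℝ] W) (ξ : W)
    (Y : ℝ → W) (Y' : ℝ → V →L[ℝ] W) : Prop where
  controlled : IsControlled α T₀ X Y Y'
  mem_domain : ∀ t ∈ Icc 0 T₀, Y t ∈ S.generator.domain
  bounded : ∃ K : ℝ, ∀ t ∈ Icc 0 T₀, ‖S.gen (Y t)‖ ≤ K
  deriv_eq : ∀ t ∈ Icc 0 T₀, Y' t = f t (Y t)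
  integrable : ∀ t ∈ Icc 0 T₀,
    IntervalIntegrable (fun s => S.gen (Y s) + f₀ s (Y s)) volume 0 t
  equation : ∀ t ∈ Icc 0 T₀, ∃ I : W,
    HasRoughIntegral X XX (fun s => f s (Y s)) (compDeriv f Y Y') 0 t I ∧
      Y t = ξ + (∫ s in (0 : ℝ)..t, (S.gen (Y s) + f₀ s (Y s))) + I

/-- A local mild solution `(Y, Y')` on `[0,T₀]` of
`dY = (A Y + f₀(t, Y)) dt + f(t, Y) d𝐗`, `Y_0 = ξ`, where `A` is the generator of `S`, for
coefficients `f₀` and `f` with values in `D(A)` and `L(V, D(A²))`. The integrand of the rough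
convolution is `S_{t-s} f(s, Y_s)`, with Gubinelli derivative `S_{t-s} f(Y)'_s`. -/
structure IsLocalMildSolution (S : C0Semigroup W) (α T₀ : ℝ) (X : ℝ → V)
    (XX : ℝ → ℝ → ProjTensor V) (f₀ : ℝ → W → Dom S.generator)
    (f : ℝ → W → V →L[ℝ] Dom2 S.generator) (ξ : W)
    (Y : ℝ → W) (Y' : ℝ → V →L[ℝ] W) : Prop where
  controlled : IsControlled α T₀ X Y Y'
  deriv_eq : ∀ t ∈ Icc 0 T₀, Y' t = (Dom2.incl S.generator).comp (f t (Y t))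
  equation : ∀ t ∈ Icc 0 T₀,
    Y t = S.op t ξ + (∫ s in (0 : ℝ)..t, S.op (t - s) (Dom.incl S.generator (f₀ s (Y s)))) +
      roughIntegral X XX
        (fun s => ((S.op (t - s)).comp (Dom2.incl S.generator)).comp (f s (Y s)))
        (fun s => (ContinuousLinearMap.compL ℝ V (Dom2 S.generator) W
          ((S.op (t - s)).comp (Dom2.incl S.generator))).comp (compDeriv f Y Y' s)) 0 t

end Solutions

end RoughPDE

end

/-!
Write `Y` for the mild solution, `A` for the generator of `S`, and put `F_t = f(t, Y_t)`, a path
controlled by `X` with values in `L(V, D(A²))` (`IsCb.isControlled_comp`).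

*Rough convolutions.* On `D(A)` the semigroup is Lipschitz in time, so `u ↦ S_{t-u} F_u` and
`u ↦ S_{t-u} A F_u` are again controlled, with constants that are uniform in `t`. The sewing lemma
(`IsAlmostAdditive.exists_isSewing`) yields the rough convolutions
`I_t = ∫₀ᵗ S_{t-r} F_r d𝐗_r` and `I'_t = ∫₀ᵗ S_{t-r} A F_r d𝐗_r`
(`RoughBounds.exists_isRoughConvolution`). A path sewn from a germ is unique (`IsSewing.unique`).
Applied to images under bounded operators, this gives the flow relation
`I_t = S_{t-s} I_s + ∫_sᵗ S_{t-r} F_r d𝐗_r` and, because `A y = z` is equivalent to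
`S_h y - y = ∫₀ʰ S_q z dq` for all `h ≥ 0` (`C0Semigroup.hasGen_iff`), also `A I_t = I'_t`
(`IsRoughConvolution.hasGen`).

*Regularity of `A Y`.* Consequently `Y` is `D(A)`-valued and `A Y` solves the mild equation with
`A ξ`, `A f₀` and `A F` in place of `ξ`, `f₀` and `F` (`hasGen_mildPath`). So
`A Y_t = S_{t-s} A Y_s + O(|t - s|^α)`, which forces `A Y` to be continuous
(`continuousOn_of_norm_sub_op_le`).

*The integrated equation.* Let `D_t = Y_t - ∫₀ᵗ (A Y + f₀(s, Y_s)) ds - ∫₀ᵗ F d𝐗`. The flow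
relation for `Y` shows that `D_t - D_s` equals `(S_{t-s} - 1) Y_s - ∫_sᵗ A Y_r dr` up to
`O(|t - s|^{3α})`, where `3α > 1`: the integrals against `𝐗` and `dr` with and without the
semigroup differ by a higher order, as their integrands lie in `D(A)`
(`IsRoughConvolution.norm_sub_sub_le`). Since `Y_s ∈ D(A)` and `A Y` is continuous, the continuous
path `D` has right derivative zero everywhere, hence is constant (`mildPath_eq_strong`). No
exchange of the order of integration is needed.
-/

namespace RoughPDE

/-! ### Semigroups and their generators -/

section SemigroupTheory

variable {W : Type*} [NormedAddCommGroup W] [NormedSpace ℝ W]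

namespace C0Semigroup

variable (S : C0Semigroup W)

theorem op_add_apply {s t : ℝ} (hs : 0 ≤ s) (ht : 0 ≤ t) (y : W) :
    S.op (s + t) y = S.op s (S.op t y) := by
  rw [S.op_add s t hs ht]; rfl

/-- If the operators were unbounded near `0`, they would be so along a sequence `t_n → 0`, against
the Banach-Steinhaus theorem. -/
theorem exists_norm_op_le_near_zero [CompleteSpace W] :
    ∃ δ > 0, ∃ M : ℝ, ∀ t ∈ Icc 0 δ, ‖S.op t‖ ≤ M := by
  by_contra! h
  have h' : ∀ n : ℕ, ∃ t ∈ Icc (0 : ℝ) (1 / ((n : ℝ) + 1)), (n : ℝ) < ‖S.op t‖ := fun n =>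
    h _ (by positivity) n
  choose t ht htn using h'
  have hlim : Tendsto t atTop (𝓝[≥] 0) :=
    tendsto_nhdsWithin_iff.2 ⟨squeeze_zero (fun n => (ht n).1) (fun n => (ht n).2)
      tendsto_one_div_add_atTop_nhds_zero_nat, Eventually.of_forall fun n => (ht n).1⟩
  obtain ⟨C, hC⟩ := banach_steinhaus (g := fun n => S.op (t n)) fun x => by
    obtain ⟨C, hC⟩ := ((S.tendsto_op x).comp hlim).norm.bddAbove_range
    exact ⟨C, fun n => hC ⟨n, rfl⟩⟩
  obtain ⟨n, hn⟩ := exists_nat_gt C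
  linarith [hC n, htn n]

/-- The operators of a strongly continuous semigroup are bounded in norm, uniformly on compact
time intervals. -/
theorem exists_norm_op_le [CompleteSpace W] (T : ℝ) :
    ∃ M : ℝ, 1 ≤ M ∧ ∀ t ∈ Icc 0 T, ‖S.op t‖ ≤ M := by
  obtain ⟨δ, hδ, M, hM⟩ := S.exists_norm_op_le_near_zero
  have key : ∀ n : ℕ, ∀ t ∈ Icc (0 : ℝ) (n * δ), ‖S.op t‖ ≤ max M 1 ^ n := by
    intro n
    induction n with
    | zero =>
      intro t ht
      have : t = 0 := le_antisymm (by simpa using ht.2) ht.1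
      subst this
      rw [S.op_zero, pow_zero]
      exact ContinuousLinearMap.norm_id_le
    | succ n ih =>
      intro t ht
      have hs : 0 ≤ min t δ := le_min ht.1 hδ.le
      have hs' : 0 ≤ t - min t δ := sub_nonneg.2 (min_le_left _ _)
      have h2 : t - min t δ ≤ n * δ := by
        rcases le_total t δ with h | h
        · rw [min_eq_left h, sub_self]; positivity
        · rw [min_eq_right h]
          have := ht.2
          push_cast at this
          linarith
      have e : t = min t δ + (t - min t δ) := by ring
      rw [e, S.op_add _ _ hs hs', pow_succ']
      refine (ContinuousLinearMap.opNorm_comp_le _ _).trans ?_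
      exact mul_le_mul ((hM _ ⟨hs, min_le_right _ _⟩).trans (le_max_left _ _)) (ih _ ⟨hs', h2⟩)
        (norm_nonneg _) (le_trans zero_le_one (le_max_right _ _))
  obtain ⟨n, hn⟩ := exists_nat_ge (T / δ)
  refine ⟨max M 1 ^ n, one_le_pow₀ (le_max_right _ _), fun t ht => key n t ⟨ht.1, ht.2.trans ?_⟩⟩
  rwa [div_le_iff₀ hδ] at hn

theorem norm_op_sub_op_le {T M : ℝ} (hM : ∀ t ∈ Icc 0 T, ‖S.op t‖ ≤ M) {s t : ℝ}
    (hs : s ∈ Icc 0 T) (ht : t ∈ Icc 0 T) (y : W) :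
    ‖S.op t y - S.op s y‖ ≤ M * ‖S.op |t - s| y - y‖ := by
  wlog h : s ≤ t generalizing s t
  · rw [norm_sub_rev, abs_sub_comm]
    exact this ht hs (le_of_not_ge h)
  have h0 : 0 ≤ t - s := sub_nonneg.2 h
  rw [abs_of_nonneg h0]
  have e : S.op t y = S.op s (S.op (t - s) y) := by
    rw [← S.op_add_apply hs.1 h0]; congr 2; ring
  rw [e, ← map_sub]
  exact (S.op s).le_of_opNorm_le (hM s hs) _

theorem continuousOn_op [CompleteSpace W] :
    ContinuousOn (fun p : ℝ × W => S.op p.1 p.2) (Ici 0 ×ˢ univ) := by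
  rintro ⟨s, z⟩ ⟨hs, -⟩
  obtain ⟨M, -, hM⟩ := S.exists_norm_op_le (s + 1)
  have hs0 : (0 : ℝ) ≤ s := hs
  have hsT : s ∈ Icc 0 (s + 1) := ⟨hs0, by linarith⟩
  rw [ContinuousWithinAt, tendsto_iff_norm_sub_tendsto_zero]
  have hfst : Tendsto (fun p : ℝ × W => p.1) (𝓝[Ici 0 ×ˢ univ] (s, z)) (𝓝 s) :=
    (continuous_fst.tendsto (s, z)).mono_left nhdsWithin_le_nhds
  have hsnd : Tendsto (fun p : ℝ × W => p.2) (𝓝[Ici 0 ×ˢ univ] (s, z)) (𝓝 z) :=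
    (continuous_snd.tendsto (s, z)).mono_left nhdsWithin_le_nhds
  have h1 : Tendsto (fun p : ℝ × W => ‖p.2 - z‖) (𝓝[Ici 0 ×ˢ univ] (s, z)) (𝓝 0) :=
    tendsto_iff_norm_sub_tendsto_zero.1 hsnd
  have h2 : Tendsto (fun p : ℝ × W => |p.1 - s|) (𝓝[Ici 0 ×ˢ univ] (s, z)) (𝓝[≥] 0) := by
    refine tendsto_nhdsWithin_iff.2 ⟨?_, Eventually.of_forall fun p => mem_Ici.2 (abs_nonneg _)⟩
    simpa using (hfst.sub_const s).abs
  have h3 := tendsto_iff_norm_sub_tendsto_zero.1 ((S.tendsto_op z).comp h2)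
  have h4 := (h1.const_mul M).add (h3.const_mul M)
  simp only [mul_zero, add_zero] at h4
  refine squeeze_zero' (Eventually.of_forall fun _ => norm_nonneg _) ?_ h4
  have hlt : ∀ᶠ p : ℝ × W in 𝓝[Ici 0 ×ˢ univ] (s, z), p.1 < s + 1 :=
    hfst.eventually (eventually_lt_nhds (by linarith))
  filter_upwards [hlt, self_mem_nhdsWithin] with p hp hp'
  have hpT : p.1 ∈ Icc 0 (s + 1) := ⟨hp'.1, hp.le⟩
  calc ‖S.op p.1 p.2 - S.op s z‖
      = ‖S.op p.1 (p.2 - z) + (S.op p.1 z - S.op s z)‖ := by rw [map_sub]; congr 1; abel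
    _ ≤ ‖S.op p.1 (p.2 - z)‖ + ‖S.op p.1 z - S.op s z‖ := norm_add_le _ _
    _ ≤ _ := add_le_add ((S.op p.1).le_of_opNorm_le (hM _ hpT) _)
      (S.norm_op_sub_op_le hM hsT hpT z)

theorem continuousOn_op_comp [CompleteSpace W] {g : ℝ → ℝ} {k : ℝ → W} {D : Set ℝ}
    (hg : ContinuousOn g D) (hk : ContinuousOn k D) (h0 : ∀ x ∈ D, 0 ≤ g x) :
    ContinuousOn (fun x => S.op (g x) (k x)) D :=
  S.continuousOn_op.comp (hg.prodMk hk) fun x hx => ⟨h0 x hx, mem_univ _⟩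

theorem continuousOn_op_apply [CompleteSpace W] (y : W) :
    ContinuousOn (fun t => S.op t y) (Ici 0) :=
  S.continuousOn_op_comp continuousOn_id continuousOn_const fun _ h => h

theorem intervalIntegrable_op [CompleteSpace W] (y : W) {h : ℝ} (hh : 0 ≤ h) :
    IntervalIntegrable (fun q => S.op q y) volume 0 h :=
  ((S.continuousOn_op_apply y).mono fun x hx => by
    rw [uIcc_of_le hh] at hx; exact hx.1).intervalIntegrable

/-- The operator `z ↦ ∫₀ʰ S_q z dq`, set to `0` when `h < 0`. -/
noncomputable def integralOp [CompleteSpace W] (h : ℝ) : W →L[ℝ] W :=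
  if hh : 0 ≤ h then
    LinearMap.mkContinuousOfExistsBound
      { toFun := fun z => ∫ q in (0 : ℝ)..h, S.op q z
        map_add' := fun x y => by
          simp only [map_add]
          exact intervalIntegral.integral_add (S.intervalIntegrable_op x hh)
            (S.intervalIntegrable_op y hh)
        map_smul' := fun c x => by simp }
      (by
        obtain ⟨M, -, hM⟩ := S.exists_norm_op_le h
        refine ⟨M * |h - 0|, fun x => ?_⟩
        refine (intervalIntegral.norm_integral_le_of_norm_le_const (C := M * ‖x‖)
          fun q hq => ?_).trans_eq (by ring)
        rw [uIoc_of_le hh] at hq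
        exact (S.op q).le_of_opNorm_le (hM q ⟨hq.1.le, hq.2⟩) x)
  else 0

theorem integralOp_apply [CompleteSpace W] {h : ℝ} (hh : 0 ≤ h) (z : W) :
    S.integralOp h z = ∫ q in (0 : ℝ)..h, S.op q z := by
  rw [integralOp, dif_pos hh]; rfl

theorem norm_integralOp_le [CompleteSpace W] {h T M : ℝ} (hh : h ∈ Icc 0 T)
    (hM : ∀ t ∈ Icc 0 T, ‖S.op t‖ ≤ M) : ‖S.integralOp h‖ ≤ M * h := by
  have hM0 : 0 ≤ M := (norm_nonneg _).trans (hM h hh)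
  refine ContinuousLinearMap.opNorm_le_bound _ (mul_nonneg hM0 hh.1) fun x => ?_
  rw [S.integralOp_apply hh.1]
  refine (intervalIntegral.norm_integral_le_of_norm_le_const (C := M * ‖x‖)
    fun q hq => ?_).trans_eq (by rw [sub_zero, abs_of_nonneg hh.1]; ring)
  rw [uIoc_of_le hh.1] at hq
  exact (S.op q).le_of_opNorm_le (hM q ⟨hq.1.le, hq.2.trans hh.2⟩) x

variable {S}

theorem HasGen.hasDerivWithinAt {y z : W} (h : S.HasGen y z) {x : ℝ} (hx : 0 ≤ x) :
    HasDerivWithinAt (fun t => S.op t y) (S.op x z) (Ici x) x := by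
  rw [← hasDerivWithinAt_Ioi_iff_Ici, hasDerivWithinAt_iff_tendsto_slope' self_notMem_Ioi]
  have h1 : Tendsto (fun t : ℝ => t - x) (𝓝[>] x) (𝓝[>] 0) := by
    refine tendsto_nhdsWithin_iff.2 ⟨?_, ?_⟩
    · exact tendsto_nhdsWithin_of_tendsto_nhds
        (by simpa using (continuous_sub_right x).tendsto x)
    · filter_upwards [self_mem_nhdsWithin] with t ht using sub_pos.2 (mem_Ioi.1 ht)
  refine (((S.op x).continuous.tendsto z).comp (h.comp h1)).congr' ?_
  filter_upwards [self_mem_nhdsWithin] with t ht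
  have h0 : 0 ≤ t - x := (sub_pos.2 (mem_Ioi.1 ht)).le
  have e : S.op t y = S.op x (S.op (t - x) y) := by
    rw [← S.op_add_apply hx h0]; congr 2; ring
  simp only [Function.comp_apply, slope_def_module, map_smul, map_sub, e]

theorem HasGen.hasDerivWithinAt_sub {y z : W} (h : S.HasGen y z) (s : ℝ) :
    HasDerivWithinAt (fun u => S.op (u - s) y) z (Ici s) s := by
  have h1 : HasDerivWithinAt (fun t => S.op t y) (S.op (s - s) z) (Ici (s - s)) (s - s) :=
    h.hasDerivWithinAt (sub_self s).ge
  have h2 := h1.scomp (h := fun u => u - s) s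
    ((hasDerivWithinAt_id s (Ici s)).sub_const s)
    (fun u (hu : s ≤ u) => mem_Ici.2 (sub_le_sub_right hu s))
  simpa [S.op_zero, Function.comp_def] using h2

/-- `A y = z` if and only if `S_h y - y = ∫₀ʰ S_q z dq` for all `h ≥ 0`. The right-hand side is
stable under limits and under bounded linear operations, so it encodes that `A` is closed. -/
theorem hasGen_iff [CompleteSpace W] {y z : W} :
    S.HasGen y z ↔ ∀ h, 0 ≤ h → S.op h y - y = S.integralOp h z := by
  constructor
  · intro H h hh
    rw [S.integralOp_apply hh, intervalIntegral.integral_eq_sub_of_hasDeriv_right_of_le hh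
      (f := fun t => S.op t y) ((S.continuousOn_op_apply y).mono fun x hx => hx.1)
      (fun x hx => (H.hasDerivWithinAt hx.1.le).mono Ioi_subset_Ici_self)
      (S.intervalIntegrable_op z hh), S.op_zero]
    rfl
  · intro H
    have hc : ContinuousWithinAt (fun q => S.op q z) (Ioi 0) 0 :=
      (S.continuousOn_op_apply z 0 self_mem_Ici).mono Ioi_subset_Ici_self
    have hm : StronglyMeasurableAtFilter (fun q => S.op q z) (𝓝[>] 0) volume :=
      ((S.continuousOn_op_apply z).mono Ioi_subset_Ici_self).stronglyMeasurableAtFilter_nhdsWithin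
        measurableSet_Ioi 0
    have hd := intervalIntegral.integral_hasDerivWithinAt_right (a := (0 : ℝ)) (b := 0)
      (s := Ici 0) (t := Ioi 0) (IntervalIntegrable.refl) hm hc
    rw [← hasDerivWithinAt_Ioi_iff_Ici, hasDerivWithinAt_iff_tendsto_slope' self_notMem_Ioi] at hd
    simp only [S.op_zero, ContinuousLinearMap.id_apply] at hd
    refine hd.congr' ?_
    filter_upwards [self_mem_nhdsWithin] with t ht
    rw [H t (le_of_lt ht), S.integralOp_apply (le_of_lt ht), slope_def_module]
    simp

theorem HasGen.op [CompleteSpace W] {y z : W} (h : S.HasGen y z) {t : ℝ} (ht : 0 ≤ t) :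
    S.HasGen (S.op t y) (S.op t z) := by
  refine (((S.op t).continuous.tendsto z).comp h).congr' ?_
  filter_upwards [self_mem_nhdsWithin] with r hr
  have hr : (0 : ℝ) < r := hr
  simp only [Function.comp_apply, map_smul, map_sub]
  rw [← S.op_add_apply ht hr.le, add_comm, S.op_add_apply hr.le ht]

/-- The generator passes through the convolution `∫₀ᵗ S_{t-r} g(r) dr`, or any other Bochner
integral of a continuous path on which it acts continuously. -/
theorem HasGen.integral [CompleteSpace W] {g k : ℝ → W} {t : ℝ} (ht : 0 ≤ t)
    (hg : ContinuousOn g (Icc 0 t)) (hk : ContinuousOn k (Icc 0 t))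
    (hgk : ∀ r ∈ Icc 0 t, S.HasGen (g r) (k r)) :
    S.HasGen (∫ r in (0 : ℝ)..t, g r) (∫ r in (0 : ℝ)..t, k r) := by
  obtain ⟨M, hM1, hM⟩ := S.exists_norm_op_le 1
  obtain ⟨K, hK⟩ := isCompact_Icc.exists_bound_of_continuousOn hk
  have hgi : IntervalIntegrable g volume 0 t := (hg.mono (uIcc_of_le ht).le).intervalIntegrable
  have main : Tendsto (fun h : ℝ => ∫ r in (0 : ℝ)..t, h⁻¹ • (S.op h (g r) - g r)) (𝓝[>] 0)
      (𝓝 (∫ r in (0 : ℝ)..t, k r)) := by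
    refine intervalIntegral.tendsto_integral_filter_of_dominated_convergence (fun _ => M * K)
      ?_ ?_ intervalIntegrable_const ?_
    · refine Eventually.of_forall fun h => ContinuousOn.aestronglyMeasurable ?_ measurableSet_uIoc
      rw [uIoc_of_le ht]
      exact ((((S.op h).continuous.comp_continuousOn hg).sub hg).const_smul h⁻¹).mono
        Ioc_subset_Icc_self
    · have : ∀ᶠ h : ℝ in 𝓝[>] 0, h < 1 :=
        mem_nhdsWithin_of_mem_nhds (eventually_lt_nhds (by norm_num))
      filter_upwards [self_mem_nhdsWithin, this] with h hh hh1
      have hh : (0 : ℝ) < h := hh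
      refine ae_of_all _ fun r hr => ?_
      rw [uIoc_of_le ht] at hr
      have hr' := Ioc_subset_Icc_self hr
      rw [hasGen_iff.1 (hgk r hr') h hh.le, norm_smul, norm_inv, Real.norm_of_nonneg hh.le,
        inv_mul_le_iff₀ hh]
      calc ‖S.integralOp h (k r)‖ ≤ M * h * K :=
            (S.integralOp h).le_of_opNorm_le_of_le
              (S.norm_integralOp_le ⟨hh.le, hh1.le⟩ hM) (hK r hr')
        _ = h * (M * K) := by ring
    · refine ae_of_all _ fun r hr => ?_
      rw [uIoc_of_le ht] at hr
      exact hgk r (Ioc_subset_Icc_self hr)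
  refine main.congr' (Eventually.of_forall fun h => ?_)
  dsimp only
  rw [intervalIntegral.integral_smul, intervalIntegral.integral_sub _ hgi,
    ContinuousLinearMap.intervalIntegral_comp_comm _ hgi]
  exact ((((S.op h).continuous.comp_continuousOn hg)).mono (uIcc_of_le ht).le).intervalIntegrable

end C0Semigroup

end SemigroupTheory

/-! ### Hölder paths -/

section Holder

variable {E : Type*} [NormedAddCommGroup E]

theorem IsHolder.exists_bound {γ T : ℝ} {Z : ℝ → E} (h : IsHolder γ T Z) (hγ : 0 ≤ γ) :
    ∃ K, 0 ≤ K ∧ ∀ t ∈ Icc 0 T, ‖Z t‖ ≤ K := by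
  obtain ⟨C, hC⟩ := h
  refine ⟨‖Z 0‖ + |C| * |T| ^ γ, by positivity, fun t ht => ?_⟩
  have h0 : (0 : ℝ) ∈ Icc 0 T := ⟨le_rfl, ht.1.trans ht.2⟩
  have h1 : ‖Z t - Z 0‖ ≤ |C| * |T| ^ γ := by
    refine (hC 0 h0 t ht).trans ?_
    refine mul_le_mul (le_abs_self C) (Real.rpow_le_rpow (abs_nonneg _) ?_ hγ)
      (by positivity) (abs_nonneg C)
    rw [sub_zero]
    exact abs_le_abs_of_nonneg ht.1 ht.2
  calc ‖Z t‖ = ‖Z 0 + (Z t - Z 0)‖ := by congr 1; abel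
    _ ≤ _ := (norm_add_le _ _).trans (add_le_add_right h1 _)

theorem IsHolder.mono {γ T T' : ℝ} {Z : ℝ → E} (h : IsHolder γ T Z) (hT : T' ≤ T) :
    IsHolder γ T' Z :=
  let ⟨C, hC⟩ := h
  ⟨C, fun s hs t ht => hC s (Icc_subset_Icc_right hT hs) t (Icc_subset_Icc_right hT ht)⟩

theorem IsHolder.continuousOn {γ T : ℝ} {Z : ℝ → E} (h : IsHolder γ T Z) (hγ : 0 < γ) :
    ContinuousOn Z (Icc 0 T) := by
  obtain ⟨C, hC⟩ := h
  intro u hu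
  rw [ContinuousWithinAt, tendsto_iff_norm_sub_tendsto_zero]
  have ht : Tendsto (fun v : ℝ => C * |v - u| ^ γ) (𝓝[Icc 0 T] u) (𝓝 0) := by
    have : ContinuousAt (fun v : ℝ => C * |v - u| ^ γ) u :=
      continuousAt_const.mul
        (((continuousAt_id.sub continuousAt_const).abs).rpow_const (Or.inr hγ.le))
    have h0 := this.tendsto
    rw [sub_self, abs_zero, Real.zero_rpow hγ.ne', mul_zero] at h0
    exact h0.mono_left nhdsWithin_le_nhds
  refine squeeze_zero' (Eventually.of_forall fun _ => norm_nonneg _) ?_ ht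
  filter_upwards [self_mem_nhdsWithin] with v hv using hC u hu v hv

theorem isHolder_of_le {γ T C : ℝ} {Z : ℝ → E}
    (h : ∀ u v, 0 ≤ u → u ≤ v → v ≤ T → ‖Z v - Z u‖ ≤ C * (v - u) ^ γ) : IsHolder γ T Z := by
  refine ⟨C, fun s hs t ht => ?_⟩
  rcases le_total s t with h1 | h1
  · rw [abs_of_nonneg (sub_nonneg.2 h1)]; exact h s t hs.1 h1 ht.2
  · rw [norm_sub_rev, abs_sub_comm, abs_of_nonneg (sub_nonneg.2 h1)]
    exact h t s ht.1 h1 hs.2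

theorem rpow_le_mul_rpow {T x β γ : ℝ} (hx : 0 ≤ x) (hxT : x ≤ T) (hγ : 0 < γ) (hβ : γ ≤ β) :
    x ^ β ≤ T ^ (β - γ) * x ^ γ := by
  have e : x ^ β = x ^ (β - γ) * x ^ γ := by
    rw [← Real.rpow_add_of_nonneg hx (by linarith) hγ.le]; congr 1; ring
  rw [e]
  exact mul_le_mul_of_nonneg_right (Real.rpow_le_rpow hx hxT (by linarith))
    (Real.rpow_nonneg hx _)

end Holder

/-! ### The sewing lemma -/

section Sewing

variable {E : Type*} [NormedAddCommGroup E]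

/-- `Ξ` is a germ on `[0,T]` which is additive up to `C |t - s|^θ`. -/
def IsAlmostAdditive (C θ T : ℝ) (Ξ : ℝ → ℝ → E) : Prop :=
  ∀ s u t, 0 ≤ s → s ≤ u → u ≤ t → t ≤ T → ‖Ξ s t - Ξ s u - Ξ u t‖ ≤ C * (t - s) ^ θ

/-- The constant `2 / (1 - 2^{1-θ})` of the sewing lemma, which is the fixed point of
`K ↦ 2^{1-θ} K + 2`: two halves of the interval contribute `K` each, scaled by `2^{-θ}`, and joining
them costs two defects of additivity. -/
noncomputable def sewingConst (θ : ℝ) : ℝ := 2 / (1 - 2 * (1 / 2 : ℝ) ^ θ)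

theorem two_mul_half_rpow_lt_one {θ : ℝ} (hθ : 1 < θ) : 2 * (1 / 2 : ℝ) ^ θ < 1 := by
  have := Real.rpow_lt_rpow_of_exponent_gt (x := 1 / 2) (by norm_num) (by norm_num) hθ
  rw [Real.rpow_one] at this
  linarith

theorem sewingConst_nonneg {θ : ℝ} (hθ : 1 < θ) : 0 ≤ sewingConst θ :=
  div_nonneg zero_le_two (by linarith [two_mul_half_rpow_lt_one hθ])

theorem sewingConst_eq {θ : ℝ} (hθ : 1 < θ) :
    sewingConst θ * (2 * (1 / 2 : ℝ) ^ θ) + 2 = sewingConst θ := by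
  have h : (1 : ℝ) - 2 * (1 / 2 : ℝ) ^ θ ≠ 0 := by linarith [two_mul_half_rpow_lt_one hθ]
  rw [sewingConst]
  field_simp
  ring

theorem IsAlmostAdditive.diag_eq_zero {C θ T : ℝ} {Ξ : ℝ → ℝ → E}
    (h : IsAlmostAdditive C θ T Ξ) (hθ : 1 < θ) {t : ℝ} (ht : t ∈ Icc 0 T) : Ξ t t = 0 := by
  have := h t t t ht.1 le_rfl le_rfl ht.2
  rw [sub_self (Ξ t t), sub_self t, Real.zero_rpow (by linarith), mul_zero] at this
  simpa using this

/-- The maximal inequality behind the sewing lemma: a Riemann sum of an almost additive germ over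
any partition differs from the germ of the whole interval by at most a constant times
`|t - s|^θ`. The partition is split at the interval containing the midpoint, and both halves are
treated by induction. -/
theorem IsAlmostAdditive.norm_sum_sub_le {C θ T : ℝ} {Ξ : ℝ → ℝ → E}
    (h : IsAlmostAdditive C θ T Ξ) (hθ : 1 < θ) (hC : 0 ≤ C) {p : ℕ → ℝ} (hp : Monotone p)
    (hp0 : ∀ i, 0 ≤ p i) (hpT : ∀ i, p i ≤ T) (k m : ℕ) (hkm : k < m) :
    ‖∑ i ∈ Finset.Ico k m, Ξ (p i) (p (i + 1)) - Ξ (p k) (p m)‖ ≤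
      sewingConst θ * C * (p m - p k) ^ θ := by
  have hθ0 : 0 ≤ θ := by linarith
  have hK := sewingConst_nonneg hθ
  induction hn : m - k using Nat.strong_induction_on generalizing k m with
  | _ n ih =>
  set d := p m - p k with hd
  have hd0 : 0 ≤ d := sub_nonneg.2 (hp hkm.le)
  -- the index `j` of the interval that contains the midpoint
  obtain ⟨j, hkj, hjm, hj1, hj2⟩ : ∃ j, k ≤ j ∧ j < m ∧ p j ≤ (p k + p m) / 2 ∧
      (p k + p m) / 2 ≤ p (j + 1) := by
    have hex : ∃ i, k < i ∧ (p k + p m) / 2 ≤ p i := ⟨m, hkm, by linarith⟩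
    classical
    obtain ⟨h1, h2⟩ := Nat.find_spec hex
    have h3 : Nat.find hex ≤ m := Nat.find_min' hex ⟨hkm, by linarith⟩
    refine ⟨Nat.find hex - 1, by omega, by omega, ?_, by
      rwa [Nat.sub_add_cancel (by omega)]⟩
    rcases eq_or_lt_of_le (show k ≤ Nat.find hex - 1 by omega) with h4 | h4
    · rw [← h4]; linarith
    · have := Nat.find_min hex (m := Nat.find hex - 1) (by omega)
      push Not at this
      exact (this h4).le
  have half : ∀ x, 0 ≤ x → x ≤ d / 2 → x ^ θ ≤ (1 / 2 : ℝ) ^ θ * d ^ θ := fun x hx hx' => by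
    rw [← Real.mul_rpow (by norm_num) hd0]
    exact Real.rpow_le_rpow hx (by linarith) hθ0
  have full : ∀ x, 0 ≤ x → x ≤ d → C * x ^ θ ≤ C * d ^ θ := fun x hx hx' =>
    mul_le_mul_of_nonneg_left (Real.rpow_le_rpow hx hx' hθ0) hC
  have zero : ∀ i, Ξ (p i) (p i) = 0 := fun i => h.diag_eq_zero hθ ⟨hp0 i, hpT i⟩
  have part : ∀ a b, k ≤ a → a ≤ b → b ≤ m → b - a < n → p b - p a ≤ d / 2 →
      ‖∑ i ∈ Finset.Ico a b, Ξ (p i) (p (i + 1)) - Ξ (p a) (p b)‖ ≤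
        sewingConst θ * C * ((1 / 2 : ℝ) ^ θ * d ^ θ) := by
    intro a b _ hab _ hlt hle
    rcases eq_or_lt_of_le hab with rfl | hab
    · simp only [Finset.Ico_self, Finset.sum_empty, zero, sub_self, norm_zero]
      positivity
    · refine (ih _ hlt a b hab rfl).trans ?_
      exact mul_le_mul_of_nonneg_left (half _ (sub_nonneg.2 (hp hab.le)) hle) (by positivity)
  have hL := part k j le_rfl hkj hjm.le (by omega) (by linarith)
  have hR := part (j + 1) m (by omega) hjm le_rfl (by omega) (by linarith)
  have h1 := h (p k) (p (j + 1)) (p m) (hp0 _) (hp (by omega)) (hp hjm) (hpT _)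
  have h2 := (h (p k) (p j) (p (j + 1)) (hp0 _) (hp hkj) (hp (by omega)) (hpT _)).trans
    (full _ (sub_nonneg.2 (hp (by omega))) (sub_le_sub_right (hp hjm) _))
  have hsum : ∑ i ∈ Finset.Ico k m, Ξ (p i) (p (i + 1)) =
      ∑ i ∈ Finset.Ico k j, Ξ (p i) (p (i + 1)) + Ξ (p j) (p (j + 1)) +
        ∑ i ∈ Finset.Ico (j + 1) m, Ξ (p i) (p (i + 1)) := by
    rw [← Finset.sum_Ico_consecutive _ hkj hjm.le, Finset.sum_eq_sum_Ico_succ_bot hjm, add_assoc]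
  have e : ∑ i ∈ Finset.Ico k m, Ξ (p i) (p (i + 1)) - Ξ (p k) (p m) =
      (∑ i ∈ Finset.Ico k j, Ξ (p i) (p (i + 1)) - Ξ (p k) (p j)) +
      (∑ i ∈ Finset.Ico (j + 1) m, Ξ (p i) (p (i + 1)) - Ξ (p (j + 1)) (p m)) -
      (Ξ (p k) (p m) - Ξ (p k) (p (j + 1)) - Ξ (p (j + 1)) (p m)) -
      (Ξ (p k) (p (j + 1)) - Ξ (p k) (p j) - Ξ (p j) (p (j + 1))) := by
    rw [hsum]; abel
  rw [e]
  have hc := sewingConst_eq hθ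
  calc _ ≤ sewingConst θ * C * ((1 / 2 : ℝ) ^ θ * d ^ θ) +
        sewingConst θ * C * ((1 / 2 : ℝ) ^ θ * d ^ θ) + C * d ^ θ + C * d ^ θ := by
        refine (norm_sub_le _ _).trans (add_le_add ((norm_sub_le _ _).trans (add_le_add
          ((norm_add_le _ _).trans (add_le_add hL hR)) h1)) h2)
    _ = (sewingConst θ * (2 * (1 / 2 : ℝ) ^ θ) + 2) * C * d ^ θ := by ring
    _ = _ := by rw [hc]

/-- A sum of `θ`-th powers (`θ > 1`) of the steps of a partition is controlled by the mesh. -/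
theorem sum_rpow_le {θ δ : ℝ} (hθ : 1 < θ) {p : ℕ → ℝ} (hp : Monotone p) (n : ℕ)
    (hδ : ∀ i < n, p (i + 1) - p i ≤ δ) :
    ∑ i ∈ Finset.range n, (p (i + 1) - p i) ^ θ ≤ δ ^ (θ - 1) * (p n - p 0) := by
  rw [← Finset.sum_range_sub, Finset.mul_sum]
  refine Finset.sum_le_sum fun i hi => ?_
  have h0 : 0 ≤ p (i + 1) - p i := sub_nonneg.2 (hp (Nat.le_succ i))
  calc (p (i + 1) - p i) ^ θ = (p (i + 1) - p i) ^ (θ - 1) * (p (i + 1) - p i) := by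
        rw [← Real.rpow_add_one' h0 (by linarith)]; congr 1; ring
    _ ≤ _ := mul_le_mul_of_nonneg_right (Real.rpow_le_rpow h0
        (hδ i (Finset.mem_range.1 hi)) (by linarith)) h0

theorem sum_range_two_mul {M : Type*} [AddCommMonoid M] (g : ℕ → M) (n : ℕ) :
    ∑ i ∈ Finset.range (2 * n), g i = ∑ i ∈ Finset.range n, (g (2 * i) + g (2 * i + 1)) := by
  induction n with
  | zero => simp
  | succ n ih =>
    rw [Nat.mul_succ, Finset.sum_range_succ, Finset.sum_range_succ, ih, Finset.sum_range_succ,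
      add_assoc]

/-- The dyadic points `i T / 2ⁿ`. -/
noncomputable def dyadic (T : ℝ) (n i : ℕ) : ℝ := i * (T / 2 ^ n)

theorem dyadic_mono {T : ℝ} (hT : 0 ≤ T) (n : ℕ) : Monotone (dyadic T n) := fun i j hij => by
  have : (i : ℝ) ≤ j := by exact_mod_cast hij
  exact mul_le_mul_of_nonneg_right this (by positivity)

theorem dyadic_two_mul (T : ℝ) (n i : ℕ) : dyadic T (n + 1) (2 * i) = dyadic T n i := by
  simp only [dyadic, pow_succ]; push_cast; field_simp

theorem dyadic_step (T : ℝ) (n i : ℕ) : dyadic T n (i + 1) - dyadic T n i = T / 2 ^ n := by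
  simp only [dyadic]; push_cast; ring

theorem dyadic_zero (T : ℝ) (n : ℕ) : dyadic T n 0 = 0 := by simp [dyadic]

theorem dyadic_top (T : ℝ) (n : ℕ) : dyadic T n (2 ^ n) = T := by
  simp only [dyadic]; push_cast; field_simp

/-- The Riemann sum of `Ξ` over the dyadic partition of `[0,T]` of level `n`, stopped at `t`. -/
noncomputable def dyadicSum (Ξ : ℝ → ℝ → E) (T : ℝ) (n : ℕ) (t : ℝ) : E :=
  ∑ i ∈ Finset.range (2 ^ n), Ξ (min (dyadic T n i) t) (min (dyadic T n (i + 1)) t)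

theorem min_sub_min_le {a b : ℝ} (hab : a ≤ b) (t : ℝ) : min b t - min a t ≤ b - a := by
  rcases le_total b t with h | h <;> rcases le_total a t with h' | h' <;>
    simp only [min_eq_left, min_eq_right, h, h'] <;> linarith

theorem div_pow_two_rpow {T : ℝ} (hT : 0 ≤ T) (θ : ℝ) (n : ℕ) :
    (2 : ℝ) ^ n * (T / 2 ^ n) ^ θ = T ^ θ * (2 * (1 / 2 : ℝ) ^ θ) ^ n := by
  rw [div_eq_mul_one_div, Real.mul_rpow hT (by positivity), mul_pow, ← one_div_pow,
    ← Real.rpow_natCast (1 / 2 : ℝ) n, ← Real.rpow_natCast ((1 / 2 : ℝ) ^ θ) n,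
    ← Real.rpow_mul (by norm_num), ← Real.rpow_mul (by norm_num), mul_comm (n : ℝ) θ]
  ring

theorem IsAlmostAdditive.norm_dyadicSum_succ_sub_le {C θ T : ℝ} {Ξ : ℝ → ℝ → E}
    (h : IsAlmostAdditive C θ T Ξ) (hθ : 1 < θ) (hC : 0 ≤ C) {t : ℝ} (ht : t ∈ Icc 0 T) (n : ℕ) :
    ‖dyadicSum Ξ T n t - dyadicSum Ξ T (n + 1) t‖ ≤
      C * T ^ θ * (2 * (1 / 2 : ℝ) ^ θ) ^ n := by
  have hT : 0 ≤ T := ht.1.trans ht.2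
  have hm := dyadic_mono hT
  have e : dyadicSum Ξ T n t - dyadicSum Ξ T (n + 1) t = ∑ i ∈ Finset.range (2 ^ n),
      (Ξ (min (dyadic T (n + 1) (2 * i)) t) (min (dyadic T (n + 1) (2 * i + 2)) t) -
        Ξ (min (dyadic T (n + 1) (2 * i)) t) (min (dyadic T (n + 1) (2 * i + 1)) t) -
        Ξ (min (dyadic T (n + 1) (2 * i + 1)) t) (min (dyadic T (n + 1) (2 * i + 2)) t)) := by
    rw [dyadicSum, dyadicSum, pow_succ', sum_range_two_mul, ← Finset.sum_sub_distrib]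
    refine Finset.sum_congr rfl fun i _ => ?_
    rw [← dyadic_two_mul T n i, ← dyadic_two_mul T n (i + 1), ← sub_sub]
    rfl
  rw [e]
  calc _ ≤ ∑ i ∈ Finset.range (2 ^ n), C * (T / 2 ^ n) ^ θ := by
        refine norm_sum_le_of_le _ fun i _ => ?_
        refine (h _ _ _ (le_min ?_ ht.1) (min_le_min_right _ (hm _ (by omega)))
          (min_le_min_right _ (hm _ (by omega))) ((min_le_right _ _).trans ht.2)).trans ?_
        · rw [← dyadic_zero T (n + 1)]; exact hm _ (Nat.zero_le _)
        · refine mul_le_mul_of_nonneg_left (Real.rpow_le_rpow (sub_nonneg.2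
            (min_le_min_right _ (hm _ (by omega)))) ?_ (by linarith)) hC
          refine (min_sub_min_le (hm _ (by omega)) t).trans_eq ?_
          rw [dyadic_two_mul, show 2 * i + 2 = 2 * (i + 1) by ring, dyadic_two_mul, dyadic_step]
    _ = C * (2 ^ n * (T / 2 ^ n) ^ θ) := by
        rw [Finset.sum_const, Finset.card_range, nsmul_eq_mul]; push_cast; ring
    _ = _ := by rw [div_pow_two_rpow hT]; ring

/-- Up to the germ of the one dyadic interval cut by `s`, the increment over `[s,t]` of the dyadic
sums is a Riemann sum over a partition of `[s,t]`. -/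
theorem IsAlmostAdditive.norm_dyadicSum_sub_sub_le {C θ T : ℝ} {Ξ : ℝ → ℝ → E}
    (h : IsAlmostAdditive C θ T Ξ) (hθ : 1 < θ) (hC : 0 ≤ C) {s t : ℝ} (hs : 0 ≤ s)
    (hst : s ≤ t) (ht : t ≤ T) (n : ℕ) :
    ‖dyadicSum Ξ T n t - dyadicSum Ξ T n s - Ξ s t‖ ≤
      C * T ^ θ * (2 * (1 / 2 : ℝ) ^ θ) ^ n + sewingConst θ * C * (t - s) ^ θ := by
  have hT : 0 ≤ T := hs.trans (hst.trans ht)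
  have hm := dyadic_mono hT n
  have h0 : ∀ i, 0 ≤ dyadic T n i := fun i => by
    rw [← dyadic_zero T n]; exact hm (Nat.zero_le _)
  set p : ℕ → ℝ := fun i => max s (min (dyadic T n i) t) with hp
  have hpm : Monotone p := fun i j hij => max_le_max le_rfl (min_le_min_right _ (hm hij))
  have hmax := h.norm_sum_sub_le hθ hC hpm (fun i => hs.trans (le_max_left _ _))
    (fun i => max_le (hst.trans ht) ((min_le_right _ _).trans ht)) 0 (2 ^ n) (by positivity)
  have hp0 : p 0 = s := by
    simp only [hp, dyadic_zero]; rw [min_eq_left (hs.trans hst), max_eq_left hs]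
  have hp1 : p (2 ^ n) = t := by
    simp only [hp, dyadic_top]; rw [min_eq_right ht, max_eq_right hst]
  rw [hp0, hp1, ← Finset.range_eq_Ico] at hmax
  have hdiff : ‖dyadicSum Ξ T n t - dyadicSum Ξ T n s -
      ∑ i ∈ Finset.range (2 ^ n), Ξ (p i) (p (i + 1))‖ ≤
      C * T ^ θ * (2 * (1 / 2 : ℝ) ^ θ) ^ n := by
    rw [dyadicSum, dyadicSum, ← Finset.sum_sub_distrib, ← Finset.sum_sub_distrib]
    calc _ ≤ ∑ i ∈ Finset.range (2 ^ n), C * (T / 2 ^ n) ^ θ := by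
          refine norm_sum_le_of_le _ fun i _ => ?_
          have hab : dyadic T n i ≤ dyadic T n (i + 1) := hm (Nat.le_succ i)
          have hstep := dyadic_step T n i
          have ha0 := h0 i
          have hpos : 0 ≤ C * (T / 2 ^ n) ^ θ := by positivity
          simp only [hp]
          generalize dyadic T n i = a at *
          generalize dyadic T n (i + 1) = b at *
          have hs0 := h.diag_eq_zero hθ (t := s) ⟨hs, hst.trans ht⟩
          rcases le_total b s with hbs | hbs
          · rw [min_eq_left hbs, min_eq_left (hab.trans hbs), min_eq_left (hbs.trans hst),
              min_eq_left ((hab.trans hbs).trans hst), max_eq_left hbs,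
              max_eq_left (hab.trans hbs), hs0]
            simpa using hpos
          · have hbt : s ≤ min b t := le_min hbs hst
            rcases le_total s a with has | has
            · rw [min_eq_right hbs, min_eq_right has, max_eq_right hbt,
                max_eq_right (le_min has hst), hs0]
              simpa using hpos
            · rw [min_eq_right hbs, min_eq_left has, max_eq_right hbt,
                min_eq_left (has.trans hst), max_eq_left has]
              refine (h a s (min b t) ha0 has hbt ((min_le_right _ _).trans ht)).trans ?_
              refine mul_le_mul_of_nonneg_left (Real.rpow_le_rpow
                (sub_nonneg.2 (has.trans hbt)) ?_ (by linarith)) hC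
              linarith [min_le_left b t]
      _ = C * (2 ^ n * (T / 2 ^ n) ^ θ) := by
          rw [Finset.sum_const, Finset.card_range, nsmul_eq_mul]; push_cast; ring
      _ = _ := by rw [div_pow_two_rpow hT]; ring
  calc _ = ‖(dyadicSum Ξ T n t - dyadicSum Ξ T n s -
      ∑ i ∈ Finset.range (2 ^ n), Ξ (p i) (p (i + 1))) +
      (∑ i ∈ Finset.range (2 ^ n), Ξ (p i) (p (i + 1)) - Ξ s t)‖ := by congr 1; abel
    _ ≤ _ := (norm_add_le _ _).trans (add_le_add hdiff hmax)

/-- A path `I` with `I_0 = 0` whose increments on `[0,T]` are given by the germ `Ξ` up to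
`K |t - s|^θ`. -/
structure IsSewing (K θ T : ℝ) (Ξ : ℝ → ℝ → E) (I : ℝ → E) : Prop where
  zero : I 0 = 0
  le : ∀ s t, 0 ≤ s → s ≤ t → t ≤ T → ‖I t - I s - Ξ s t‖ ≤ K * (t - s) ^ θ

/-- The sewing lemma. The path is the limit of the dyadic sums, which makes it additive by
construction; the estimate over an arbitrary interval comes from the maximal inequality. -/
theorem IsAlmostAdditive.exists_isSewing [CompleteSpace E] {C θ T : ℝ} {Ξ : ℝ → ℝ → E}
    (h : IsAlmostAdditive C θ T Ξ) (hθ : 1 < θ) (hC : 0 ≤ C) :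
    ∃ I, IsSewing (sewingConst θ * C) θ T Ξ I := by
  have hr0 : 0 ≤ 2 * (1 / 2 : ℝ) ^ θ := by positivity
  have hr1 := two_mul_half_rpow_lt_one hθ
  have hlim : ∀ t, ∃ x, t ∈ Icc 0 T → Tendsto (fun n => dyadicSum Ξ T n t) atTop (𝓝 x) := by
    intro t
    by_cases ht : t ∈ Icc 0 T
    · obtain ⟨x, hx⟩ := cauchySeq_tendsto_of_complete
        (cauchySeq_of_le_geometric (f := fun n => dyadicSum Ξ T n t) (2 * (1 / 2 : ℝ) ^ θ)
          (C * T ^ θ) hr1 fun n => by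
          rw [dist_eq_norm]
          exact h.norm_dyadicSum_succ_sub_le hθ hC ht n)
      exact ⟨x, fun _ => hx⟩
    · exact ⟨0, fun h => absurd h ht⟩
  choose J hJ using hlim
  refine ⟨fun t => J t - J 0, sub_self _, fun s t hs hst ht => ?_⟩
  have h1 : Tendsto (fun n => dyadicSum Ξ T n t - dyadicSum Ξ T n s - Ξ s t) atTop
      (𝓝 (J t - J s - Ξ s t)) :=
    ((hJ t ⟨hs.trans hst, ht⟩).sub (hJ s ⟨hs, hst.trans ht⟩)).sub_const (Ξ s t)
  have h2 : Tendsto (fun n : ℕ => C * T ^ θ * (2 * (1 / 2 : ℝ) ^ θ) ^ n +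
      sewingConst θ * C * (t - s) ^ θ) atTop (𝓝 (sewingConst θ * C * (t - s) ^ θ)) := by
    simpa using ((tendsto_pow_atTop_nhds_zero_of_lt_one hr0 hr1).const_mul
      (C * T ^ θ)).add_const (sewingConst θ * C * (t - s) ^ θ)
  change ‖J t - J 0 - (J s - J 0) - Ξ s t‖ ≤ _
  rw [sub_sub_sub_cancel_right]
  exact le_of_tendsto_of_tendsto' h1.norm h2 fun n =>
    h.norm_dyadicSum_sub_sub_le hθ hC hs hst ht n

theorem hasDerivWithinAt_zero_of_norm_sub_le [NormedSpace ℝ E] {D : ℝ → E} {K θ u T : ℝ}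
    (hθ : 1 < θ) (hu : u < T)
    (h : ∀ v ∈ Icc u T, ‖D v - D u‖ ≤ K * (v - u) ^ θ) : HasDerivWithinAt D 0 (Ici u) u := by
  rw [hasDerivWithinAt_iff_isLittleO]
  have hO : (fun v => D v - D u - (v - u) • (0 : E)) =O[𝓝[≥] u] fun v => (v - u) ^ θ := by
    refine Asymptotics.IsBigO.of_bound K ?_
    filter_upwards [Icc_mem_nhdsGE hu] with v hv
    rw [smul_zero, sub_zero, Real.norm_of_nonneg (Real.rpow_nonneg (sub_nonneg.2 hv.1) _)]
    exact h v hv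
  refine hO.trans_isLittleO ?_
  have ht : Tendsto (fun v : ℝ => (v - u) ^ (θ - 1)) (𝓝[≥] u) (𝓝 0) := by
    have : ContinuousAt (fun v : ℝ => (v - u) ^ (θ - 1)) u :=
      (continuousAt_id.sub continuousAt_const).rpow_const (Or.inr (by linarith))
    have h0 := this.tendsto
    rw [sub_self, Real.zero_rpow (by linarith)] at h0
    exact h0.mono_left nhdsWithin_le_nhds
  have h1 := ((Asymptotics.isLittleO_one_iff ℝ).2 ht).mul_isBigO
    (Asymptotics.isBigO_refl (fun v : ℝ => v - u) (𝓝[≥] u))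
  simp only [one_mul] at h1
  refine h1.congr' ?_ EventuallyEq.rfl
  filter_upwards [self_mem_nhdsWithin] with v hv
  rw [← Real.rpow_add_one' (sub_nonneg.2 hv) (by linarith)]
  congr 1; ring

theorem IsSewing.unique [NormedSpace ℝ E] {K K' θ T : ℝ} {Ξ : ℝ → ℝ → E} {I I' : ℝ → E}
    (h : IsSewing K θ T Ξ I) (h' : IsSewing K' θ T Ξ I') (hθ : 1 < θ) :
    ∀ t ∈ Icc 0 T, I t = I' t := by
  set D : ℝ → E := fun t => I t - I' t with hD
  have hb : ∀ u v, 0 ≤ u → u ≤ v → v ≤ T → ‖D v - D u‖ ≤ (K + K') * (v - u) ^ θ := by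
    intro u v hu huv hv
    have e : D v - D u = (I v - I u - Ξ u v) - (I' v - I' u - Ξ u v) := by simp only [hD]; abel
    rw [e, add_mul]
    exact (norm_sub_le _ _).trans (add_le_add (h.le u v hu huv hv) (h'.le u v hu huv hv))
  have hc : ContinuousOn D (Icc 0 T) := (isHolder_of_le hb).continuousOn (by linarith)
  intro t ht
  have := constant_of_has_deriv_right_zero hc (fun u hu =>
    hasDerivWithinAt_zero_of_norm_sub_le hθ hu.2 fun v hv => hb u v hu.1 hv.1 hv.2) t ht
  simp only [hD, h.zero, h'.zero, sub_self] at this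
  exact sub_eq_zero.1 this

theorem IsSewing.mono {K θ T T' : ℝ} {Ξ : ℝ → ℝ → E} {I : ℝ → E} (h : IsSewing K θ T Ξ I)
    (hT : T' ≤ T) : IsSewing K θ T' Ξ I :=
  ⟨h.zero, fun s t hs hst ht => h.le s t hs hst (ht.trans hT)⟩

/-- Bounded linear images of sewn paths are sewn from the image germ. -/
theorem IsSewing.clm_comp [NormedSpace ℝ E] {F : Type*} [NormedAddCommGroup F]
    [NormedSpace ℝ F] {K θ T : ℝ} {Ξ : ℝ → ℝ → E} {Ξ' : ℝ → ℝ → F} {I : ℝ → E}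
    (h : IsSewing K θ T Ξ I) (B : E →L[ℝ] F)
    (hB : ∀ s t, 0 ≤ s → s ≤ t → t ≤ T → Ξ' s t = B (Ξ s t)) :
    IsSewing (‖B‖ * K) θ T Ξ' fun t => B (I t) := by
  refine ⟨by simp [h.zero], fun s t hs hst ht => ?_⟩
  rw [hB s t hs hst ht, ← map_sub, ← map_sub, mul_assoc]
  exact B.le_opNorm_of_le (h.le s t hs hst ht)

/-- Riemann sums of the germ over partitions of `[0,b]` converge to the sewn path at `b` as the
mesh tends to zero. -/
theorem IsSewing.exists_mesh {K θ T b : ℝ} {Ξ : ℝ → ℝ → E} {I : ℝ → E}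
    (h : IsSewing K θ T Ξ I) (hθ : 1 < θ) (hb : b ≤ T) {ε : ℝ} (hε : 0 < ε) :
    ∃ δ > 0, ∀ (n : ℕ) (p : ℕ → ℝ), Monotone p → p 0 = 0 → p n = b →
      (∀ i < n, p (i + 1) - p i < δ) →
      ‖∑ i ∈ Finset.range n, Ξ (p i) (p (i + 1)) - I b‖ < ε := by
  have ht : Tendsto (fun δ : ℝ => |K| * (δ ^ (θ - 1) * b)) (𝓝[>] 0) (𝓝 0) := by
    have : ContinuousAt (fun δ : ℝ => |K| * (δ ^ (θ - 1) * b)) 0 :=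
      continuousAt_const.mul
        ((continuousAt_id.rpow_const (Or.inr (by linarith))).mul continuousAt_const)
    have h0 := this.tendsto
    rw [Real.zero_rpow (by linarith), zero_mul, mul_zero] at h0
    exact h0.mono_left nhdsWithin_le_nhds
  obtain ⟨δ, hδε, hδ⟩ := ((ht.eventually (eventually_lt_nhds hε)).and self_mem_nhdsWithin).exists
  refine ⟨δ, hδ, fun n p hp hp0 hpn hmesh => lt_of_le_of_lt ?_ hδε⟩
  have e : ∑ i ∈ Finset.range n, Ξ (p i) (p (i + 1)) - I b =
      -∑ i ∈ Finset.range n, (I (p (i + 1)) - I (p i) - Ξ (p i) (p (i + 1))) := by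
    rw [Finset.sum_sub_distrib, Finset.sum_range_sub (fun i => I (p i)), hp0, hpn, h.zero]
    abel
  rw [e, norm_neg]
  calc _ ≤ ∑ i ∈ Finset.range n, |K| * (p (i + 1) - p i) ^ θ := by
        refine norm_sum_le_of_le _ fun i hi => ?_
        have hi' := Finset.mem_range.1 hi
        have h1 : p i ≤ p (i + 1) := hp (Nat.le_succ i)
        refine (h.le _ _ (hp0 ▸ hp (Nat.zero_le i)) h1
          ((hp (show i + 1 ≤ n from hi')).trans (hpn.le.trans hb))).trans ?_
        exact mul_le_mul_of_nonneg_right (le_abs_self K)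
          (Real.rpow_nonneg (sub_nonneg.2 h1) _)
    _ ≤ _ := by
        rw [← Finset.mul_sum]
        refine mul_le_mul_of_nonneg_left ?_ (abs_nonneg K)
        have := sum_rpow_le hθ hp n fun i hi => (hmesh i hi).le
        rwa [hp0, hpn, sub_zero] at this

end Sewing

/-! ### Functionals on the projective tensor product -/

section TensorLift

variable {V W : Type*} [NormedAddCommGroup V] [NormedSpace ℝ V] [NormedAddCommGroup W]
  [NormedSpace ℝ W]

/-- Bounded operators on `V ⊗ V` are determined by their values on elementary tensors, which span a
dense subspace. -/
theorem projTensor_ext {Φ Ψ : ProjTensor V →L[ℝ] W}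
    (h : ∀ v w, Φ (tmul v w) = Ψ (tmul v w)) : Φ = Ψ := by
  have hlin : Φ.toLinearMap ∘ₗ
      (UniformSpace.Completion.toComplL (𝕜 := ℝ) (E := ⨂[ℝ] _ : Fin 2, V)).toLinearMap =
      Ψ.toLinearMap ∘ₗ
      (UniformSpace.Completion.toComplL (𝕜 := ℝ) (E := ⨂[ℝ] _ : Fin 2, V)).toLinearMap := by
    refine PiTensorProduct.ext (MultilinearMap.ext fun m => ?_)
    have hm : m = ![m 0, m 1] := by ext i; fin_cases i <;> rfl
    rw [hm]
    exact h (m 0) (m 1)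
  refine ContinuousLinearMap.coeFn_injective ?_
  exact UniformSpace.Completion.denseRange_coe.equalizer Φ.continuous Ψ.continuous
    (funext fun x => LinearMap.congr_fun hlin x)

variable [CompleteSpace W]

theorem tensorLift_coe (B : V →L[ℝ] V →L[ℝ] W) (x : ⨂[ℝ] _ : Fin 2, V) :
    tensorLift B (x : ProjTensor V) =
      PiTensorProduct.liftIsometry ℝ (fun _ : Fin 2 => V) W (biMulti B) x :=
  ContinuousLinearMap.extend_eq
    (PiTensorProduct.liftIsometry ℝ (fun _ : Fin 2 => V) W (biMulti B))
    (e := UniformSpace.Completion.toComplL (𝕜 := ℝ) (E := ⨂[ℝ] _ : Fin 2, V))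
    UniformSpace.Completion.denseRange_coe
    (UniformSpace.Completion.isUniformInducing_coe _) x

theorem norm_tensorLift_le (B : V →L[ℝ] V →L[ℝ] W) : ‖tensorLift B‖ ≤ ‖B‖ := by
  refine ContinuousLinearMap.opNorm_le_bound _ (norm_nonneg B) fun x : ProjTensor V => ?_
  induction x using UniformSpace.Completion.induction_on with
  | hp =>
    exact isClosed_le (tensorLift B).continuous.norm
      (continuous_const.mul (continuous_norm (E := ProjTensor V)))
  | ih x =>
    rw [tensorLift_coe, UniformSpace.Completion.norm_coe]
    refine ContinuousLinearMap.le_of_opNorm_le _ ?_ x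
    rw [LinearIsometryEquiv.norm_map]
    exact MultilinearMap.mkContinuous_norm_le _ (norm_nonneg B) _

theorem tensorLift_sub (B B' : V →L[ℝ] V →L[ℝ] W) :
    tensorLift (B - B') = tensorLift B - tensorLift B' :=
  projTensor_ext fun v w => by simp [tensorLift_tmul]

theorem tensorLift_comp {W' : Type*} [NormedAddCommGroup W'] [NormedSpace ℝ W']
    [CompleteSpace W'] (G : W →L[ℝ] W') (B : V →L[ℝ] V →L[ℝ] W) :
    tensorLift ((ContinuousLinearMap.compL ℝ V W W' G).comp B) = G.comp (tensorLift B) :=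
  projTensor_ext fun v w => by simp [tensorLift_tmul]

end TensorLift

/-! ### The germ of a rough integral -/

section Germ

variable {V W E : Type*} [NormedAddCommGroup V] [NormedSpace ℝ V] [NormedAddCommGroup W]
  [NormedSpace ℝ W] [NormedAddCommGroup E]

theorem IsRoughPath.mono {α T T' : ℝ} {X : ℝ → V} {XX : ℝ → ℝ → ProjTensor V}
    (h : IsRoughPath α T X XX) (hT : T' ≤ T) : IsRoughPath α T' X XX where
  holder := h.holder.mono hT
  holder₂ := by
    obtain ⟨C, hC⟩ := h.holder₂
    exact ⟨C, fun s hs t ht =>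
      hC s (Icc_subset_Icc_right hT hs) t (Icc_subset_Icc_right hT ht)⟩
  chen s hs u hu t ht := h.chen s (Icc_subset_Icc_right hT hs) u (Icc_subset_Icc_right hT hu) t
    (Icc_subset_Icc_right hT ht)

variable [NormedSpace ℝ E]

/-- One constant for all the bounds that enter the theory of the rough integral of `(F, F')`
against `(X, 𝕏)` on `[0,T]`. -/
structure RoughBounds (K α T : ℝ) (X : ℝ → V) (XX : ℝ → ℝ → ProjTensor V)
    (F : ℝ → V →L[ℝ] E) (F' : ℝ → V →L[ℝ] V →L[ℝ] E) : Prop where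
  nonneg : 0 ≤ K
  path : ∀ u v, 0 ≤ u → u ≤ v → v ≤ T → ‖X v - X u‖ ≤ K * (v - u) ^ α
  area : ∀ u v, 0 ≤ u → u ≤ v → v ≤ T → ‖XX u v‖ ≤ K * (v - u) ^ (2 * α)
  val : ∀ u, 0 ≤ u → u ≤ T → ‖F u‖ ≤ K
  deriv : ∀ u, 0 ≤ u → u ≤ T → ‖F' u‖ ≤ K
  deriv_sub : ∀ u v, 0 ≤ u → u ≤ v → v ≤ T → ‖F' v - F' u‖ ≤ K * (v - u) ^ α
  remainder : ∀ u v, 0 ≤ u → u ≤ v → v ≤ T →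
    ‖F v - F u - F' u (X v - X u)‖ ≤ K * (v - u) ^ (2 * α)

theorem IsControlled.exists_roughBounds {α T : ℝ} {X : ℝ → V} {XX : ℝ → ℝ → ProjTensor V}
    {F : ℝ → V →L[ℝ] E} {F' : ℝ → V →L[ℝ] V →L[ℝ] E} (hF : IsControlled α T X F F')
    (hX : IsRoughPath α T X XX) (hα : 0 ≤ α) : ∃ K, RoughBounds K α T X XX F F' := by
  obtain ⟨C1, h1⟩ := hX.holder
  obtain ⟨C2, h2⟩ := hX.holder₂
  obtain ⟨C3, hC3, h3⟩ := hF.holder.exists_bound hα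
  obtain ⟨C4, hC4, h4⟩ := hF.holder_deriv.exists_bound hα
  obtain ⟨C5, h5⟩ := hF.holder_deriv
  obtain ⟨C6, h6⟩ := hF.remainder
  have a1 := le_abs_self C1
  have a2 := le_abs_self C2
  have a5 := le_abs_self C5
  have a6 := le_abs_self C6
  have b1 := abs_nonneg C1
  have b2 := abs_nonneg C2
  have b5 := abs_nonneg C5
  have b6 := abs_nonneg C6
  have key : ∀ (C γ u v x : ℝ), u ≤ v → C ≤ |C1| + |C2| + C3 + C4 + |C5| + |C6| →
      x ≤ C * |v - u| ^ γ → x ≤ (|C1| + |C2| + C3 + C4 + |C5| + |C6|) * (v - u) ^ γ := by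
    intro C γ u v x huv hC hx
    rw [abs_of_nonneg (sub_nonneg.2 huv)] at hx
    exact hx.trans (mul_le_mul_of_nonneg_right hC (Real.rpow_nonneg (sub_nonneg.2 huv) _))
  refine ⟨|C1| + |C2| + C3 + C4 + |C5| + |C6|, by positivity, ?_, ?_, ?_, ?_, ?_, ?_⟩
  · exact fun u v hu huv hv => key C1 _ _ _ _ huv (by linarith)
      (h1 u ⟨hu, huv.trans hv⟩ v ⟨hu.trans huv, hv⟩)
  · exact fun u v hu huv hv => key C2 _ _ _ _ huv (by linarith)
      (h2 u ⟨hu, huv.trans hv⟩ v ⟨hu.trans huv, hv⟩)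
  · exact fun u hu huT => (h3 u ⟨hu, huT⟩).trans (by linarith)
  · exact fun u hu huT => (h4 u ⟨hu, huT⟩).trans (by linarith)
  · exact fun u v hu huv hv => key C5 _ _ _ _ huv (by linarith)
      (h5 u ⟨hu, huv.trans hv⟩ v ⟨hu.trans huv, hv⟩)
  · exact fun u v hu huv hv => key C6 _ _ _ _ huv (by linarith)
      (h6 u ⟨hu, huv.trans hv⟩ v ⟨hu.trans huv, hv⟩)

theorem norm_compL_comp_le (L : E →L[ℝ] W) (B : V →L[ℝ] V →L[ℝ] E) :
    ‖(ContinuousLinearMap.compL ℝ V E W L).comp B‖ ≤ ‖L‖ * ‖B‖ := by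
  refine ContinuousLinearMap.opNorm_le_bound _ (by positivity) fun v => ?_
  rw [mul_assoc]
  exact (ContinuousLinearMap.opNorm_comp_le L (B v)).trans
    (mul_le_mul_of_nonneg_left (B.le_opNorm v) (norm_nonneg L))

variable [CompleteSpace W]

/-- The germ `L_u (F_u X_{u,v} + F'_u 𝕏_{u,v})` of the rough integral of `(L F, L F')`, where `L`
is a path of operators. -/
noncomputable def roughGerm (X : ℝ → V) (XX : ℝ → ℝ → ProjTensor V) (F : ℝ → V →L[ℝ] E)
    (F' : ℝ → V →L[ℝ] V →L[ℝ] E) (L : ℝ → E →L[ℝ] W) (u v : ℝ) : W :=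
  L u (F u (X v - X u)) +
    tensorLift ((ContinuousLinearMap.compL ℝ V E W (L u)).comp (F' u)) (XX u v)

variable {X : ℝ → V} {XX : ℝ → ℝ → ProjTensor V} {F : ℝ → V →L[ℝ] E}
  {F' : ℝ → V →L[ℝ] V →L[ℝ] E}

theorem roughGerm_clm_comp (L : ℝ → E →L[ℝ] W) (G : ℝ → W →L[ℝ] W) (u v : ℝ) :
    roughGerm X XX F F' (fun r => (G r).comp (L r)) u v = G u (roughGerm X XX F F' L u v) := by
  rw [roughGerm, roughGerm, map_add]
  congr 1
  rw [← ContinuousLinearMap.comp_apply, ← tensorLift_comp]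
  rfl

namespace RoughBounds

variable {K α T : ℝ}

theorem norm_roughGerm_le (h : RoughBounds K α T X XX F F') (hα : 0 < α) {M : ℝ}
    {L : ℝ → E →L[ℝ] W} {u v : ℝ} (hu : 0 ≤ u) (huv : u ≤ v) (hv : v ≤ T) (hL : ‖L u‖ ≤ M) :
    ‖roughGerm X XX F F' L u v‖ ≤ M * K * K * (1 + T ^ α) * (v - u) ^ α := by
  have hK := h.nonneg
  have hM : 0 ≤ M := (norm_nonneg _).trans hL
  have h1 : ‖L u (F u (X v - X u))‖ ≤ M * (K * (K * (v - u) ^ α)) :=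
    (L u).le_of_opNorm_le_of_le hL ((F u).le_of_opNorm_le_of_le (h.val u hu (huv.trans hv))
      (h.path u v hu huv hv))
  have h2 : ‖tensorLift ((ContinuousLinearMap.compL ℝ V E W (L u)).comp (F' u)) (XX u v)‖ ≤
      M * K * (K * (v - u) ^ (2 * α)) :=
    ContinuousLinearMap.le_of_opNorm_le_of_le _ (((norm_tensorLift_le _).trans
      (norm_compL_comp_le _ _)).trans (mul_le_mul hL (h.deriv u hu (huv.trans hv))
        (norm_nonneg (F' u)) hM)) (h.area u v hu huv hv)
  have h3 : (v - u) ^ (2 * α) ≤ T ^ α * (v - u) ^ α := by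
    have := rpow_le_mul_rpow (T := T) (sub_nonneg.2 huv) (by linarith) hα
      (show α ≤ 2 * α by linarith)
    rwa [show 2 * α - α = α by ring] at this
  calc _ ≤ M * (K * (K * (v - u) ^ α)) + M * K * (K * (T ^ α * (v - u) ^ α)) :=
        (norm_add_le _ _).trans (add_le_add h1 (h2.trans (by gcongr)))
    _ = _ := by ring

/-- Chen's relation makes the germ of the rough integral almost additive of order `3 α`, with a
constant which depends on the operators `L` only through their sup and Lipschitz norms. -/
theorem exists_isAlmostAdditive (h : RoughBounds K α T X XX F F') (hX : IsRoughPath α T X XX)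
    (hα : 0 < α) (hα' : α ≤ 1 / 2) {M N : ℝ} (hM : 0 ≤ M) (hN : 0 ≤ N) :
    ∃ C, 0 ≤ C ∧ ∀ t ≤ T, ∀ L : ℝ → E →L[ℝ] W, (∀ u, 0 ≤ u → u ≤ t → ‖L u‖ ≤ M) →
      (∀ u v, 0 ≤ u → u ≤ v → v ≤ t → ‖L v - L u‖ ≤ N * (v - u)) →
      IsAlmostAdditive C (3 * α) t (roughGerm X XX F F' L) := by
  have hK := h.nonneg
  set A : ℝ := M * K + N * |T| ^ (1 - 2 * α) * (K + K * (K * |T| ^ α)) with hA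
  set B : ℝ := M * K + N * |T| ^ (1 - α) * K with hB
  have hA0 : 0 ≤ A := by positivity
  have hB0 : 0 ≤ B := by positivity
  refine ⟨A * K + B * K, by positivity, fun t htT L hLM hLN s u v hs hsu huv hvt => ?_⟩
  have hut : u ≤ t := huv.trans hvt
  have hst : s ≤ t := hsu.trans hut
  have hu : 0 ≤ u := hs.trans hsu
  have huT : u ≤ T := hut.trans htT
  have hvT : v ≤ T := hvt.trans htT
  have hd0 : 0 ≤ u - s := sub_nonneg.2 hsu
  have hdT : u - s ≤ |T| := by linarith [le_abs_self T]
  -- the remainder and the increment of the derivative of `(L F, L F')`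
  have hp1 : u - s ≤ |T| ^ (1 - α) * (u - s) ^ α := by
    have := rpow_le_mul_rpow hd0 hdT hα (show α ≤ 1 by linarith)
    rwa [Real.rpow_one] at this
  have hp2 : u - s ≤ |T| ^ (1 - 2 * α) * (u - s) ^ (2 * α) := by
    have := rpow_le_mul_rpow hd0 hdT (show 0 < 2 * α by linarith) (show 2 * α ≤ 1 by linarith)
    rwa [Real.rpow_one] at this
  set Rm : V →L[ℝ] W := (L u).comp (F u) - (L s).comp (F s) - (L s).comp (F' s (X u - X s))
    with hRm
  set Dm : V →L[ℝ] V →L[ℝ] W := (ContinuousLinearMap.compL ℝ V E W (L u)).comp (F' u) -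
    (ContinuousLinearMap.compL ℝ V E W (L s)).comp (F' s) with hDm
  have hR : ‖Rm‖ ≤ A * (u - s) ^ (2 * α) := by
    have e : Rm = (L u).comp (F u - F s - F' s (X u - X s)) +
        (L u - L s).comp (F s + F' s (X u - X s)) := by
      ext x; simp [hRm]; abel
    have h1 : ‖F s + F' s (X u - X s)‖ ≤ K + K * (K * |T| ^ α) := by
      refine (norm_add_le _ _).trans (add_le_add (h.val s hs (hst.trans htT)) ?_)
      refine (F' s).le_of_opNorm_le_of_le (h.deriv s hs (hst.trans htT))
        ((h.path s u hs hsu huT).trans ?_)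
      exact mul_le_mul_of_nonneg_left (Real.rpow_le_rpow hd0 hdT hα.le) hK
    rw [e]
    calc _ ≤ M * (K * (u - s) ^ (2 * α)) +
          N * (|T| ^ (1 - 2 * α) * (u - s) ^ (2 * α)) * (K + K * (K * |T| ^ α)) := by
          refine (norm_add_le _ _).trans (add_le_add
            ((ContinuousLinearMap.opNorm_comp_le _ _).trans (mul_le_mul (hLM u hu hut)
              (h.remainder s u hs hsu huT) (norm_nonneg _) hM))
            ((ContinuousLinearMap.opNorm_comp_le _ _).trans (mul_le_mul
              ((hLN s u hs hsu hut).trans (mul_le_mul_of_nonneg_left hp2 hN)) h1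
              (norm_nonneg _) (by positivity))))
      _ = _ := by rw [hA]; ring
  have hD : ‖Dm‖ ≤ B * (u - s) ^ α := by
    have e : Dm = (ContinuousLinearMap.compL ℝ V E W (L u)).comp (F' u - F' s) +
        (ContinuousLinearMap.compL ℝ V E W (L u - L s)).comp (F' s) := by
      ext x y; simp [hDm]
    have h1 : ‖(ContinuousLinearMap.compL ℝ V E W (L u)).comp (F' u - F' s)‖ ≤
        M * (K * (u - s) ^ α) :=
      (norm_compL_comp_le _ _).trans (mul_le_mul (hLM u hu hut)
        (h.deriv_sub s u hs hsu huT) (norm_nonneg (F' u - F' s)) hM)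
    have h2 : ‖(ContinuousLinearMap.compL ℝ V E W (L u - L s)).comp (F' s)‖ ≤
        N * (|T| ^ (1 - α) * (u - s) ^ α) * K :=
      (norm_compL_comp_le _ _).trans (mul_le_mul
        ((hLN s u hs hsu hut).trans (mul_le_mul_of_nonneg_left hp1 hN))
        (h.deriv s hs (hst.trans htT)) (norm_nonneg (F' s)) (by positivity))
    rw [e]
    refine ((norm_add_le (_ : V →L[ℝ] V →L[ℝ] W) _).trans (add_le_add h1 h2)).trans_eq ?_
    rw [hB]
    ring
  have hchen : XX s v = XX s u + XX u v + tmul (X u - X s) (X v - X u) := by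
    rw [← hX.chen s ⟨hs, hst.trans htT⟩ u ⟨hu, huT⟩ v ⟨hu.trans huv, hvT⟩]; abel
  have e : roughGerm X XX F F' L s v - roughGerm X XX F F' L s u - roughGerm X XX F F' L u v =
      -(Rm (X v - X u) + tensorLift Dm (XX u v)) := by
    rw [roughGerm, roughGerm, roughGerm, hDm, tensorLift_sub, hchen, map_add, map_add,
      tensorLift_tmul, show X v - X s = (X u - X s) + (X v - X u) by abel]
    simp only [hRm, sub_apply, ContinuousLinearMap.comp_apply, map_add,
      ContinuousLinearMap.compL_apply]
    abel
  have hvu0 : 0 ≤ v - u := sub_nonneg.2 huv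
  have hα3 : (0 : ℝ) ≤ 3 * α := by linarith
  have hle : ∀ β γ : ℝ, 0 ≤ β → 0 ≤ γ → β + γ = 3 * α →
      (u - s) ^ β * (v - u) ^ γ ≤ (v - s) ^ (3 * α) := by
    intro β γ hβ hγ hβγ
    rw [← hβγ, Real.rpow_add_of_nonneg (by linarith) hβ hγ]
    exact mul_le_mul (Real.rpow_le_rpow hd0 (by linarith) hβ)
      (Real.rpow_le_rpow hvu0 (by linarith) hγ) (by positivity)
      (Real.rpow_nonneg (by linarith) _)
  have l1 := hle (2 * α) α (by linarith) hα.le (by ring)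
  have l2 := hle α (2 * α) hα.le (by linarith) (by ring)
  rw [e, norm_neg]
  calc _ ≤ A * (u - s) ^ (2 * α) * (K * (v - u) ^ α) +
        B * (u - s) ^ α * (K * (v - u) ^ (2 * α)) :=
        (norm_add_le _ _).trans (add_le_add
          (Rm.le_of_opNorm_le_of_le hR (h.path u v hu huv hvT))
          (ContinuousLinearMap.le_of_opNorm_le_of_le _ ((norm_tensorLift_le _).trans hD)
            (h.area u v hu huv hvT)))
    _ = A * K * ((u - s) ^ (2 * α) * (v - u) ^ α) +
        B * K * ((u - s) ^ α * (v - u) ^ (2 * α)) := by ring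
    _ ≤ A * K * (v - s) ^ (3 * α) + B * K * (v - s) ^ (3 * α) := by gcongr
    _ = _ := by ring

theorem exists_isSewing (h : RoughBounds K α T X XX F F') (hX : IsRoughPath α T X XX)
    (hα : 1 / 3 < α) (hα' : α ≤ 1 / 2) {M N : ℝ} (hM : 0 ≤ M) (hN : 0 ≤ N) :
    ∃ C, 0 ≤ C ∧ ∀ t ≤ T, ∀ L : ℝ → E →L[ℝ] W, (∀ u, 0 ≤ u → u ≤ t → ‖L u‖ ≤ M) →
      (∀ u v, 0 ≤ u → u ≤ v → v ≤ t → ‖L v - L u‖ ≤ N * (v - u)) →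
      ∃ I, IsSewing C (3 * α) t (roughGerm X XX F F' L) I := by
  obtain ⟨C, hC, H⟩ := h.exists_isAlmostAdditive (W := W) hX (by linarith) hα' hM hN
  exact ⟨sewingConst (3 * α) * C, mul_nonneg (sewingConst_nonneg (by linarith)) hC,
    fun t ht L h1 h2 => (H t ht L h1 h2).exists_isSewing (by linarith) hC⟩

end RoughBounds

theorem IsSewing.hasRoughIntegral {K θ T b : ℝ} {L : ℝ → E →L[ℝ] W} {I : ℝ → W}
    (h : IsSewing K θ T (roughGerm X XX F F' L) I) (hθ : 1 < θ) (hb : b ≤ T) :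
    HasRoughIntegral X XX (fun s => (L s).comp (F s))
      (fun s => (ContinuousLinearMap.compL ℝ V E W (L s)).comp (F' s)) 0 b (I b) :=
  fun _ hε => h.exists_mesh hθ hb hε

theorem HasRoughIntegral.unique {Z : ℝ → V →L[ℝ] W} {Z' : ℝ → V →L[ℝ] V →L[ℝ] W} {a b : ℝ}
    {I I' : W} (hab : a ≤ b) (h : HasRoughIntegral X XX Z Z' a b I)
    (h' : HasRoughIntegral X XX Z Z' a b I') : I = I' := by
  by_contra hne
  have hε : 0 < ‖I - I'‖ / 2 := half_pos (norm_pos_iff.2 (sub_ne_zero.2 hne))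
  obtain ⟨δ, hδ, H⟩ := h _ hε
  obtain ⟨δ', hδ', H'⟩ := h' _ hε
  obtain ⟨n, hn⟩ := exists_nat_gt ((b - a) / min δ δ')
  have hm : 0 < min δ δ' := lt_min hδ hδ'
  have hn0 : (0 : ℝ) < n := lt_of_le_of_lt (div_nonneg (sub_nonneg.2 hab) hm.le) hn
  have hstep : (b - a) / n < min δ δ' := by
    rw [div_lt_iff₀ hm] at hn
    rw [div_lt_iff₀ hn0]; linarith
  have hmono : Monotone fun i : ℕ => a + i * ((b - a) / n) := fun i j hij => by
    have : (i : ℝ) ≤ j := by exact_mod_cast hij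
    have h2 : 0 ≤ (b - a) / n := div_nonneg (sub_nonneg.2 hab) hn0.le
    dsimp only
    gcongr
  have h0 : a + ((0 : ℕ) : ℝ) * ((b - a) / n) = a := by simp
  have h1 : a + (n : ℝ) * ((b - a) / n) = b := by field_simp; ring
  have hlt : ∀ i < n, a + ((i + 1 : ℕ) : ℝ) * ((b - a) / n) - (a + i * ((b - a) / n)) <
      min δ δ' := fun i _ => by push_cast; linarith
  have k1 := H n _ hmono h0 h1 fun i hi => (hlt i hi).trans_le (min_le_left _ _)
  have k2 := H' n _ hmono h0 h1 fun i hi => (hlt i hi).trans_le (min_le_right _ _)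
  have k3 := norm_sub_le_norm_sub_add_norm_sub I (∑ i ∈ Finset.range n,
    (Z (a + i * ((b - a) / n)) (X (a + ((i + 1 : ℕ) : ℝ) * ((b - a) / n)) -
      X (a + i * ((b - a) / n))) + tensorLift (Z' (a + i * ((b - a) / n)))
        (XX (a + i * ((b - a) / n)) (a + ((i + 1 : ℕ) : ℝ) * ((b - a) / n))))) I'
  rw [← norm_sub_rev] at k1
  exact absurd (add_lt_add k1 k2) (by rw [add_halves]; exact not_lt.2 k3)

theorem HasRoughIntegral.roughIntegral_eq {Z : ℝ → V →L[ℝ] W} {Z' : ℝ → V →L[ℝ] V →L[ℝ] W}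
    {a b : ℝ} {I : W} (hab : a ≤ b) (h : HasRoughIntegral X XX Z Z' a b I) :
    roughIntegral X XX Z Z' a b = I := by
  have hex : ∃ I, HasRoughIntegral X XX Z Z' a b I := ⟨I, h⟩
  rw [roughIntegral, dif_pos hex]
  exact hex.choose_spec.unique hab h

end Germ

/-! ### Smooth functions of controlled paths -/

section Composition

variable {V W E : Type*} [NormedAddCommGroup V] [NormedSpace ℝ V] [NormedAddCommGroup W]
  [NormedSpace ℝ W] [NormedAddCommGroup E] [NormedSpace ℝ E]

/-- The bounds on a function of class `C_b^{γ,2}` that enter the composition with controlled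
paths, in terms of Fréchet derivatives. -/
theorem IsCb.exists_bounds {γ T : ℝ} {f : ℝ → W → E} (hf : IsCb γ 2 T f) :
    ∃ C, 0 ≤ C ∧
      (∀ t ∈ Icc 0 T, ∀ y, ‖fderiv ℝ (f t) y‖ ≤ C) ∧
      (∀ t ∈ Icc 0 T, ∀ y z, ‖fderiv ℝ (f t) y - fderiv ℝ (f t) z‖ ≤ C * ‖y - z‖) ∧
      (∀ t ∈ Icc 0 T, ∀ y z, ‖f t y - f t z - fderiv ℝ (f t) z (y - z)‖ ≤ C * ‖y - z‖ ^ 2) ∧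
      (∀ s ∈ Icc 0 T, ∀ t ∈ Icc 0 T, ∀ y, ‖f t y - f s y‖ ≤ C * |t - s| ^ γ) ∧
      (∀ s ∈ Icc 0 T, ∀ t ∈ Icc 0 T, ∀ y,
        ‖fderiv ℝ (f t) y - fderiv ℝ (f s) y‖ ≤ C * |t - s| ^ γ) := by
  obtain ⟨C1, h1⟩ := hf.bounded
  obtain ⟨C2, h2⟩ := hf.holder
  have hC1 : C1 ≤ max |C1| |C2| := (le_abs_self _).trans (le_max_left _ _)
  have hC2 : C2 ≤ max |C1| |C2| := (le_abs_self _).trans (le_max_right _ _)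
  have hcd : ∀ t ∈ Icc 0 T, ContDiff ℝ 2 (f t) := fun t ht => hf.contDiff t ht
  have hd : ∀ t ∈ Icc 0 T, Differentiable ℝ (f t) := fun t ht =>
    (hcd t ht).differentiable (by norm_num)
  have hd' : ∀ t ∈ Icc 0 T, Differentiable ℝ (fderiv ℝ (f t)) := fun t ht =>
    ((hcd t ht).fderiv_right (m := 1) (by norm_num)).differentiable (by norm_num)
  have hlip : ∀ t ∈ Icc 0 T, ∀ y z,
      ‖fderiv ℝ (f t) y - fderiv ℝ (f t) z‖ ≤ max |C1| |C2| * ‖y - z‖ := fun t ht y z =>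
    Convex.norm_image_sub_le_of_norm_fderiv_le (𝕜 := ℝ) (fun x _ => hd' t ht x)
      (fun x _ => by
        rw [← norm_iteratedFDeriv_one, norm_iteratedFDeriv_fderiv]
        exact (h1 2 le_rfl t ht x).trans hC1) convex_univ (mem_univ z) (mem_univ y)
  refine ⟨max |C1| |C2|, (abs_nonneg _).trans (le_max_left _ _), ?_, hlip, ?_, ?_, ?_⟩
  · intro t ht y
    rw [← norm_iteratedFDeriv_one]
    exact (h1 1 (by norm_num) t ht y).trans hC1
  · intro t ht y z
    have h := Convex.norm_image_sub_le_of_norm_fderiv_le' (𝕜 := ℝ) (f := f t)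
      (φ := fderiv ℝ (f t) z) (C := max |C1| |C2| * ‖y - z‖) (s := segment ℝ z y)
      (fun x _ => hd t ht x) (fun x hx => (hlip t ht x z).trans ?_) (convex_segment z y)
      (left_mem_segment ℝ z y) (right_mem_segment ℝ z y)
    · rwa [mul_assoc, ← pow_two] at h
    · refine mul_le_mul_of_nonneg_left ?_ ((abs_nonneg _).trans (le_max_left _ _))
      obtain ⟨a, b, ha, hb, hab, rfl⟩ := hx
      have e : a • z + b • y - z = b • (y - z) := by
        rw [← eq_sub_iff_add_eq] at hab
        rw [hab, sub_smul, smul_sub, one_smul]; abel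
      rw [e, norm_smul, Real.norm_of_nonneg hb]
      exact mul_le_of_le_one_left (norm_nonneg _) (by linarith)
  · intro s hs t ht y
    have h := h2 0 (by norm_num) y s hs t ht
    rw [← iteratedFDeriv_sub_apply (((hcd t ht).of_le (by norm_num)).contDiffAt)
      (((hcd s hs).of_le (by norm_num)).contDiffAt), norm_iteratedFDeriv_zero] at h
    exact h.trans (mul_le_mul_of_nonneg_right hC2 (by positivity))
  · intro s hs t ht y
    have h := h2 1 (by norm_num) y s hs t ht
    rw [← iteratedFDeriv_sub_apply (((hcd t ht).of_le (by norm_num)).contDiffAt)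
      (((hcd s hs).of_le (by norm_num)).contDiffAt), norm_iteratedFDeriv_one,
      fderiv_sub (hd t ht y) (hd s hs y)] at h
    exact h.trans (mul_le_mul_of_nonneg_right hC2 (by positivity))

/-- A function of class `C_b^{2α,2}` maps controlled paths to controlled paths. -/
theorem IsCb.isControlled_comp {α T T₀ : ℝ} {f : ℝ → W → E} {X : ℝ → V} {Y : ℝ → W}
    {Y' : ℝ → V →L[ℝ] W} (hf : IsCb (2 * α) 2 T f) (hα : 0 < α) (hT : T₀ ≤ T)
    (hY : IsControlled α T₀ X Y Y') :
    IsControlled α T₀ X (fun t => f t (Y t)) (compDeriv f Y Y') := by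
  obtain ⟨C, hC, hDb, hDl, hTay, hft, hDt⟩ := hf.exists_bounds
  obtain ⟨A, hA⟩ := hY.holder
  obtain ⟨B, hB⟩ := hY.holder_deriv
  obtain ⟨R, hR⟩ := hY.remainder
  obtain ⟨K, hK, hYK⟩ := hY.holder_deriv.exists_bound hα.le
  have hsub : Icc 0 T₀ ⊆ Icc 0 T := Icc_subset_Icc_right hT
  have hp : ∀ s ∈ Icc 0 T₀, ∀ t ∈ Icc 0 T₀, |t - s| ^ (2 * α) ≤ T₀ ^ α * |t - s| ^ α := by
    intro s hs t ht
    have := rpow_le_mul_rpow (T := T₀) (abs_nonneg (t - s))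
      (abs_sub_le_iff.2 ⟨by linarith [hs.1, ht.2], by linarith [hs.2, ht.1]⟩) hα
      (show α ≤ 2 * α by linarith)
    rwa [show 2 * α - α = α by ring] at this
  have hAn : ∀ s ∈ Icc 0 T₀, ∀ t ∈ Icc 0 T₀, ‖Y t - Y s‖ ≤ |A| * |t - s| ^ α :=
    fun s hs t ht => (hA s hs t ht).trans
      (mul_le_mul_of_nonneg_right (le_abs_self A) (by positivity))
  refine ⟨⟨C * T₀ ^ α + C * |A|, fun s hs t ht => ?_⟩,
    ⟨C * B + (C * T₀ ^ α + C * |A|) * K, fun s hs t ht => ?_⟩,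
    ⟨C + C * |A| ^ 2 + C * R, fun s hs t ht => ?_⟩⟩
  · have h1 := hft s (hsub hs) t (hsub ht) (Y t)
    have h2 : ‖f s (Y t) - f s (Y s)‖ ≤ C * ‖Y t - Y s‖ :=
      Convex.norm_image_sub_le_of_norm_fderiv_le (𝕜 := ℝ)
        (fun x _ => (hf.contDiff s (hsub hs)).differentiable (by norm_num) x)
        (fun x _ => hDb s (hsub hs) x) convex_univ (mem_univ _) (mem_univ _)
    calc ‖f t (Y t) - f s (Y s)‖ = ‖(f t (Y t) - f s (Y t)) + (f s (Y t) - f s (Y s))‖ := by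
          congr 1; abel
      _ ≤ C * (T₀ ^ α * |t - s| ^ α) + C * (|A| * |t - s| ^ α) :=
          (norm_add_le _ _).trans (add_le_add
            (h1.trans (mul_le_mul_of_nonneg_left (hp s hs t ht) hC))
            (h2.trans (mul_le_mul_of_nonneg_left (hAn s hs t ht) hC)))
      _ = _ := by ring
  · have h1 : ‖fderiv ℝ (f t) (Y t) - fderiv ℝ (f s) (Y s)‖ ≤
        (C * T₀ ^ α + C * |A|) * |t - s| ^ α := by
      calc _ = ‖(fderiv ℝ (f t) (Y t) - fderiv ℝ (f s) (Y t)) +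
            (fderiv ℝ (f s) (Y t) - fderiv ℝ (f s) (Y s))‖ := by congr 1; abel
        _ ≤ C * (T₀ ^ α * |t - s| ^ α) + C * (|A| * |t - s| ^ α) :=
          (norm_add_le _ _).trans (add_le_add
            ((hDt s (hsub hs) t (hsub ht) (Y t)).trans
              (mul_le_mul_of_nonneg_left (hp s hs t ht) hC))
            ((hDl s (hsub hs) (Y t) (Y s)).trans
              (mul_le_mul_of_nonneg_left (hAn s hs t ht) hC)))
        _ = _ := by ring
    have e : compDeriv f Y Y' t - compDeriv f Y Y' s =
        (fderiv ℝ (f t) (Y t)).comp (Y' t - Y' s) +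
          (fderiv ℝ (f t) (Y t) - fderiv ℝ (f s) (Y s)).comp (Y' s) := by
      ext v; simp [compDeriv]
    rw [e]
    calc _ ≤ C * (B * |t - s| ^ α) + (C * T₀ ^ α + C * |A|) * |t - s| ^ α * K :=
          (norm_add_le _ _).trans (add_le_add
            ((ContinuousLinearMap.opNorm_comp_le _ _).trans (mul_le_mul (hDb t (hsub ht) _)
              (hB s hs t ht) (norm_nonneg _) hC))
            ((ContinuousLinearMap.opNorm_comp_le _ _).trans (mul_le_mul h1
              (hYK s hs) (norm_nonneg _) ((norm_nonneg _).trans h1))))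
      _ = _ := by ring
  · have h3 : ‖Y t - Y s‖ ^ 2 ≤ |A| ^ 2 * |t - s| ^ (2 * α) := by
      have := pow_le_pow_left₀ (norm_nonneg _) (hAn s hs t ht) 2
      rwa [mul_pow, ← Real.rpow_mul_natCast (abs_nonneg _), mul_comm α, Nat.cast_ofNat] at this
    calc ‖f t (Y t) - f s (Y s) - compDeriv f Y Y' s (X t - X s)‖
        = ‖(f t (Y t) - f s (Y t)) +
          (f s (Y t) - f s (Y s) - fderiv ℝ (f s) (Y s) (Y t - Y s)) +
          fderiv ℝ (f s) (Y s) (Y t - Y s - Y' s (X t - X s))‖ := by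
          congr 1; simp only [compDeriv, ContinuousLinearMap.comp_apply, map_sub]; abel
      _ ≤ C * |t - s| ^ (2 * α) + C * (|A| ^ 2 * |t - s| ^ (2 * α)) +
          C * (R * |t - s| ^ (2 * α)) :=
          norm_add₃_le.trans (add_le_add (add_le_add (hft s (hsub hs) t (hsub ht) (Y t))
            ((hTay s (hsub hs) (Y t) (Y s)).trans (mul_le_mul_of_nonneg_left h3 hC)))
            (ContinuousLinearMap.le_of_opNorm_le_of_le _ (hDb s (hsub hs) _) (hR s hs t ht)))
      _ = _ := by ring

theorem IsCb.compDeriv_clm_comp {γ T : ℝ} {f : ℝ → W → V →L[ℝ] E} {Y : ℝ → W}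
    {Y' : ℝ → V →L[ℝ] W} {n : ℕ} (hf : IsCb γ n T f) (hn : n ≠ 0) (L : E →L[ℝ] W) {t : ℝ}
    (ht : t ∈ Icc 0 T) :
    compDeriv (fun t y => L.comp (f t y)) Y Y' t =
      (ContinuousLinearMap.compL ℝ V E W L).comp (compDeriv f Y Y' t) := by
  have hd : DifferentiableAt ℝ (f t) (Y t) :=
    (hf.contDiff t ht).differentiable (by exact_mod_cast hn) (Y t)
  have h := ((ContinuousLinearMap.compL ℝ V E W L).hasFDerivAt.comp (Y t) hd.hasFDerivAt).fderiv
  have h' : fderiv ℝ (fun y => L.comp (f t y)) (Y t) =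
      (ContinuousLinearMap.compL ℝ V E W L).comp (fderiv ℝ (f t) (Y t)) := h
  rw [compDeriv, h']
  rfl

theorem HasRoughIntegral.congr [CompleteSpace W] {X : ℝ → V} {XX : ℝ → ℝ → ProjTensor V}
    {Z₁ Z₂ : ℝ → V →L[ℝ] W} {Z₁' Z₂' : ℝ → V →L[ℝ] V →L[ℝ] W} {a b : ℝ} {I : W}
    (h : HasRoughIntegral X XX Z₁ Z₁' a b I) (hZ : ∀ s ∈ Icc a b, Z₁ s = Z₂ s)
    (hZ' : ∀ s ∈ Icc a b, Z₁' s = Z₂' s) : HasRoughIntegral X XX Z₂ Z₂' a b I := by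
  intro ε hε
  obtain ⟨δ, hδ, H⟩ := h ε hε
  refine ⟨δ, hδ, fun n p hp hp0 hpn hmesh => ?_⟩
  rw [← Finset.sum_congr rfl fun i hi => ?_]
  · exact H n p hp hp0 hpn hmesh
  · have hi' : p i ∈ Icc a b :=
      ⟨hp0 ▸ hp (Nat.zero_le i), hpn ▸ hp (Finset.mem_range.1 hi).le⟩
    rw [hZ _ hi', hZ' _ hi']

end Composition

/-! ### Rough convolutions -/

section Convolution

variable {V W E : Type*} [NormedAddCommGroup V] [NormedSpace ℝ V] [NormedAddCommGroup W]
  [NormedSpace ℝ W] [NormedAddCommGroup E] [NormedSpace ℝ E] [CompleteSpace W]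
  {S : C0Semigroup W} {X : ℝ → V} {XX : ℝ → ℝ → ProjTensor V} {F : ℝ → V →L[ℝ] E}
  {F' : ℝ → V →L[ℝ] V →L[ℝ] E} {K α T : ℝ} {L₀ L₁ L₂ : E →L[ℝ] W}

/-- The operator `L₁` is the composition of the generator of `S` with `L₀`. -/
def GenComp (S : C0Semigroup W) (L₀ L₁ : E →L[ℝ] W) : Prop :=
  ∀ y, S.HasGen (L₀ y) (L₁ y)

theorem GenComp.op_comp_sub (h : GenComp S L₀ L₁) {r : ℝ} (hr : 0 ≤ r) :
    (S.op r).comp L₀ - L₀ = (S.integralOp r).comp L₁ := by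
  ext y
  exact C0Semigroup.hasGen_iff.1 (h y) r hr

theorem roughGerm_sub (L L' : ℝ → E →L[ℝ] W) (u v : ℝ) :
    roughGerm X XX F F' (fun r => L r - L' r) u v =
      roughGerm X XX F F' L u v - roughGerm X XX F F' L' u v := by
  have e : (ContinuousLinearMap.compL ℝ V E W (L u - L' u)).comp (F' u) =
      (ContinuousLinearMap.compL ℝ V E W (L u)).comp (F' u) -
        (ContinuousLinearMap.compL ℝ V E W (L' u)).comp (F' u) := by
    ext; simp
  rw [roughGerm, roughGerm, roughGerm, e, tensorLift_sub]
  simp only [sub_apply]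
  abel

theorem GenComp.hasGen_roughGerm (h : GenComp S L₀ L₁) (u v : ℝ) :
    S.HasGen (roughGerm X XX F F' (fun _ => L₀) u v) (roughGerm X XX F F' (fun _ => L₁) u v) := by
  refine C0Semigroup.hasGen_iff.2 fun r hr => ?_
  rw [← roughGerm_clm_comp (fun _ => L₀) (fun _ => S.op r), ← roughGerm_sub,
    ← roughGerm_clm_comp (fun _ => L₁) (fun _ => S.integralOp r), h.op_comp_sub hr]

/-- The germ of the rough convolution `∫ S_{t-r} L₀ F_r d𝐗_r`. -/
noncomputable def convGerm (S : C0Semigroup W) (X : ℝ → V) (XX : ℝ → ℝ → ProjTensor V)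
    (F : ℝ → V →L[ℝ] E) (F' : ℝ → V →L[ℝ] V →L[ℝ] E) (L₀ : E →L[ℝ] W) (t : ℝ) : ℝ → ℝ → W :=
  roughGerm X XX F F' fun u => (S.op (t - u)).comp L₀

theorem convGerm_eq (t u v : ℝ) :
    convGerm S X XX F F' L₀ t u v = S.op (t - u) (roughGerm X XX F F' (fun _ => L₀) u v) :=
  roughGerm_clm_comp (fun _ => L₀) (fun u => S.op (t - u)) u v

/-- `I t` is the indefinite rough integral `s ↦ ∫₀ˢ S_{t-r} L₀ F_r d𝐗_r`, for every `t` in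
`[0,T]`, with a remainder estimate that is uniform in `t`. -/
def IsRoughConvolution (C α T : ℝ) (S : C0Semigroup W) (X : ℝ → V) (XX : ℝ → ℝ → ProjTensor V)
    (F : ℝ → V →L[ℝ] E) (F' : ℝ → V →L[ℝ] V →L[ℝ] E) (L₀ : E →L[ℝ] W) (I : ℝ → ℝ → W) : Prop :=
  ∀ t ≤ T, IsSewing C (3 * α) t (convGerm S X XX F F' L₀ t) (I t)

/-- The rough convolution exists: since `L₀` takes values in the domain of the generator, the
operators `S_{t-u} L₀` are Lipschitz in `u` for the operator norm. -/
theorem RoughBounds.exists_isRoughConvolution (h : RoughBounds K α T X XX F F')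
    (hX : IsRoughPath α T X XX) (hα : 1 / 3 < α) (hα' : α ≤ 1 / 2) (hL : GenComp S L₀ L₁) :
    ∃ C, 0 ≤ C ∧ ∃ I, IsRoughConvolution C α T S X XX F F' L₀ I := by
  obtain ⟨M, hM1, hM⟩ := S.exists_norm_op_le T
  have hM0 : 0 ≤ M := by linarith
  obtain ⟨C, hC, H⟩ := h.exists_isSewing (W := W) hX hα hα' (M := M * ‖L₀‖)
    (N := M * (M * ‖L₁‖)) (by positivity) (by positivity)
  have H' : ∀ t, ∃ I, t ≤ T → IsSewing C (3 * α) t (convGerm S X XX F F' L₀ t) I := by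
    intro t
    by_cases ht : t ≤ T
    · obtain ⟨I, hI⟩ := H t ht (fun u => (S.op (t - u)).comp L₀)
        (fun u hu hut => (ContinuousLinearMap.opNorm_comp_le _ _).trans
          (mul_le_mul_of_nonneg_right (hM _ ⟨sub_nonneg.2 hut, by linarith⟩) (norm_nonneg _)))
        (fun u v hu huv hvt => by
          have hvu : 0 ≤ v - u := sub_nonneg.2 huv
          have e : (S.op (t - v)).comp L₀ - (S.op (t - u)).comp L₀ =
              -(S.op (t - v)).comp ((S.integralOp (v - u)).comp L₁) := by
            rw [← hL.op_comp_sub hvu, ContinuousLinearMap.comp_sub,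
              ← ContinuousLinearMap.comp_assoc, ← S.op_add _ _ (sub_nonneg.2 hvt) hvu,
              show t - v + (v - u) = t - u by ring]
            abel
          rw [e, norm_neg]
          calc _ ≤ M * (M * (v - u) * ‖L₁‖) :=
                (ContinuousLinearMap.opNorm_comp_le _ _).trans (mul_le_mul
                  (hM _ ⟨sub_nonneg.2 hvt, by linarith⟩)
                  ((ContinuousLinearMap.opNorm_comp_le _ _).trans (mul_le_mul_of_nonneg_right
                    (S.norm_integralOp_le ⟨hvu, by linarith⟩ hM) (norm_nonneg _)))
                  (norm_nonneg _) hM0)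
            _ = _ := by ring)
      exact ⟨I, fun _ => hI⟩
    · exact ⟨0, fun h => absurd h ht⟩
  choose I hI using H'
  exact ⟨C, hC, I, hI⟩

namespace IsRoughConvolution

variable {C : ℝ} {I : ℝ → ℝ → W}

theorem flow (h : IsRoughConvolution C α T S X XX F F' L₀ I) (hα : 1 / 3 < α) {s t : ℝ}
    (hs : 0 ≤ s) (hst : s ≤ t) (ht : t ≤ T) : I t s = S.op (t - s) (I s s) := by
  refine IsSewing.unique ((h t ht).mono hst) ((h s (hst.trans ht)).clm_comp (S.op (t - s))
    fun u v hu huv hv => ?_) (by linarith) s ⟨hs, le_rfl⟩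
  rw [convGerm_eq, convGerm_eq,
    ← S.op_add_apply (sub_nonneg.2 hst) (sub_nonneg.2 (huv.trans hv))]
  congr 2; ring

/-- The generator passes under the rough convolution. -/
theorem hasGen {C' : ℝ} {I' : ℝ → ℝ → W} (h : IsRoughConvolution C α T S X XX F F' L₀ I)
    (h' : IsRoughConvolution C' α T S X XX F F' L₁ I') (hL : GenComp S L₀ L₁) (hα : 1 / 3 < α)
    {t : ℝ} (ht : t ∈ Icc 0 T) : S.HasGen (I t t) (I' t t) := by
  refine C0Semigroup.hasGen_iff.2 fun r hr => ?_
  have h1 := (h t ht.2).clm_comp (Ξ' := fun u v => S.integralOp r (convGerm S X XX F F' L₁ t u v))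
    (S.op r - ContinuousLinearMap.id ℝ W) fun u v hu huv hv => by
      rw [convGerm_eq, convGerm_eq, ← C0Semigroup.hasGen_iff.1
        ((hL.hasGen_roughGerm u v).op (sub_nonneg.2 (huv.trans hv))) r hr]
      rfl
  have h2 := (h' t ht.2).clm_comp
    (Ξ' := fun u v => S.integralOp r (convGerm S X XX F F' L₁ t u v)) (S.integralOp r)
    fun _ _ _ _ _ => rfl
  exact h1.unique h2 (by linarith) t ⟨ht.1, le_rfl⟩

theorem norm_sub_le (h : IsRoughConvolution C α T S X XX F F' L₀ I) (hα : 1 / 3 < α)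
    (hB : RoughBounds K α T X XX F F') :
    ∃ D, 0 ≤ D ∧ ∀ s t, 0 ≤ s → s ≤ t → t ≤ T → ‖I t t - I t s‖ ≤ D * (t - s) ^ α := by
  obtain ⟨M, hM1, hM⟩ := S.exists_norm_op_le T
  have hK := hB.nonneg
  refine ⟨|C| * |T| ^ (3 * α - α) + M * (‖L₀‖ * K * K * (1 + |T| ^ α)), by positivity,
    fun s t hs hst ht => ?_⟩
  have hts : 0 ≤ t - s := sub_nonneg.2 hst
  have hT : 0 ≤ T := hs.trans (hst.trans ht)
  have h1 := (h t ht).le s t hs hst le_rfl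
  have h2 := hB.norm_roughGerm_le (by linarith) hs hst ht (L := fun _ => L₀) le_rfl
  have h3 := (S.op (t - s)).le_of_opNorm_le_of_le (hM _ ⟨hts, by linarith⟩) h2
  rw [← convGerm_eq] at h3
  have h4 : C * (t - s) ^ (3 * α) ≤ |C| * (|T| ^ (3 * α - α) * (t - s) ^ α) :=
    mul_le_mul (le_abs_self C) (rpow_le_mul_rpow hts (by rw [abs_of_nonneg hT]; linarith)
      (by linarith) (by linarith)) (Real.rpow_nonneg hts _) (abs_nonneg C)
  rw [abs_of_nonneg hT] at *
  calc ‖I t t - I t s‖ = ‖(I t t - I t s - convGerm S X XX F F' L₀ t s t) +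
        convGerm S X XX F F' L₀ t s t‖ := by congr 1; abel
    _ ≤ _ := (norm_add_le _ _).trans (add_le_add (h1.trans h4) h3)
    _ = _ := by ring

/-- On short intervals the rough convolution and the rough integral agree to order `3 α`. -/
theorem norm_sub_sub_le {C' : ℝ} {J : ℝ → W} (h : IsRoughConvolution C α T S X XX F F' L₀ I)
    (hJ : IsSewing C' (3 * α) T (roughGerm X XX F F' fun _ => L₀) J) (hL : GenComp S L₀ L₁)
    (hα : 1 / 3 < α) (hα' : α ≤ 1 / 2) (hB : RoughBounds K α T X XX F F') :
    ∃ D, ∀ s t, 0 ≤ s → s ≤ t → t ≤ T →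
      ‖I t t - I t s - (J t - J s)‖ ≤ D * (t - s) ^ (3 * α) := by
  obtain ⟨M, hM1, hM⟩ := S.exists_norm_op_le T
  have hK := hB.nonneg
  refine ⟨C + C' + M * (‖L₁‖ * K * K * (1 + T ^ α)) * T ^ (1 + α - 3 * α),
    fun s t hs hst ht => ?_⟩
  have hts : 0 ≤ t - s := sub_nonneg.2 hst
  have hT : 0 ≤ T := hs.trans (hst.trans ht)
  have h1 := (h t ht).le s t hs hst le_rfl
  have h2 := hJ.le s t hs hst ht
  have h3 := (S.integralOp (t - s)).le_of_opNorm_le_of_le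
    (S.norm_integralOp_le ⟨hts, by linarith⟩ hM)
    (hB.norm_roughGerm_le (by linarith) hs hst ht (L := fun _ => L₁) le_rfl)
  rw [← C0Semigroup.hasGen_iff.1 (hL.hasGen_roughGerm s t) _ hts, ← convGerm_eq] at h3
  have h4 : (t - s) ^ (1 + α) ≤ T ^ (1 + α - 3 * α) * (t - s) ^ (3 * α) :=
    rpow_le_mul_rpow hts (by linarith) (by linarith) (by linarith)
  have h5 : (t - s) * (t - s) ^ α = (t - s) ^ (1 + α) := by
    rw [Real.rpow_add_of_nonneg hts zero_le_one (by linarith), Real.rpow_one]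
  calc _ = ‖(I t t - I t s - convGerm S X XX F F' L₀ t s t) -
        (J t - J s - roughGerm X XX F F' (fun _ => L₀) s t) +
        (convGerm S X XX F F' L₀ t s t - roughGerm X XX F F' (fun _ => L₀) s t)‖ := by
        congr 1; abel
    _ ≤ C * (t - s) ^ (3 * α) + C' * (t - s) ^ (3 * α) + M * (t - s) *
        (‖L₁‖ * K * K * (1 + T ^ α) * (t - s) ^ α) :=
        (norm_add_le _ _).trans (add_le_add ((_root_.norm_sub_le _ _).trans (add_le_add h1 h2)) h3)
    _ = C * (t - s) ^ (3 * α) + C' * (t - s) ^ (3 * α) +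
        M * (‖L₁‖ * K * K * (1 + T ^ α)) * ((t - s) * (t - s) ^ α) := by ring
    _ ≤ C * (t - s) ^ (3 * α) + C' * (t - s) ^ (3 * α) +
        M * (‖L₁‖ * K * K * (1 + T ^ α)) * (T ^ (1 + α - 3 * α) * (t - s) ^ (3 * α)) := by
        rw [h5]; gcongr
    _ = _ := by ring

end IsRoughConvolution

/-! ### Mild paths -/

/-- The path `S_t x + ∫₀ᵗ S_{t-r} g_r dr + ∫₀ᵗ S_{t-r} L₀ F_r d𝐗_r`, where `I` is the rough
convolution. -/
noncomputable def mildPath (S : C0Semigroup W) (x : W) (g : ℝ → W) (I : ℝ → ℝ → W) (t : ℝ) : W :=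
  S.op t x + (∫ r in (0 : ℝ)..t, S.op (t - r) (g r)) + I t t

theorem continuousOn_op_sub {g : ℝ → W} {a t : ℝ} (hg : ContinuousOn g (Icc a t)) :
    ContinuousOn (fun r => S.op (t - r) (g r)) (Icc a t) :=
  S.continuousOn_op_comp (continuousOn_const.sub continuousOn_id) hg
    fun _ hr => sub_nonneg.2 hr.2

theorem intervalIntegrable_op_sub {g : ℝ → W} {a b t : ℝ} (hab : a ≤ b) (hbt : b ≤ t)
    (hg : ContinuousOn g (Icc a t)) :
    IntervalIntegrable (fun r => S.op (t - r) (g r)) volume a b :=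
  ((continuousOn_op_sub hg).mono (by
    rw [uIcc_of_le hab]; exact Icc_subset_Icc_right hbt)).intervalIntegrable

variable {C C' : ℝ} {I I' : ℝ → ℝ → W} {x x' : W} {g g' : ℝ → W}

theorem mildPath_flow (h : IsRoughConvolution C α T S X XX F F' L₀ I) (hα : 1 / 3 < α)
    (hg : ContinuousOn g (Icc 0 T)) {s t : ℝ} (hs : 0 ≤ s) (hst : s ≤ t) (ht : t ≤ T) :
    mildPath S x g I t = S.op (t - s) (mildPath S x g I s) +
      (∫ r in s..t, S.op (t - r) (g r)) + (I t t - I t s) := by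
  have hts : 0 ≤ t - s := sub_nonneg.2 hst
  have hg1 : ContinuousOn g (Icc 0 t) := hg.mono (Icc_subset_Icc_right ht)
  have hg2 : ContinuousOn g (Icc 0 s) := hg1.mono (Icc_subset_Icc_right hst)
  have h1 : S.op t x = S.op (t - s) (S.op s x) := by
    rw [← S.op_add_apply hts hs]; congr 2; ring
  have h2 : S.op (t - s) (∫ r in (0 : ℝ)..s, S.op (s - r) (g r)) =
      ∫ r in (0 : ℝ)..s, S.op (t - r) (g r) := by
    rw [← ContinuousLinearMap.intervalIntegral_comp_comm _
      (intervalIntegrable_op_sub hs le_rfl hg2)]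
    refine intervalIntegral.integral_congr fun r hr => ?_
    rw [uIcc_of_le hs] at hr
    rw [← S.op_add_apply hts (sub_nonneg.2 hr.2)]
    congr 2; ring
  have h3 := intervalIntegral.integral_add_adjacent_intervals
    (intervalIntegrable_op_sub (S := S) hs hst hg1)
    (intervalIntegrable_op_sub (S := S) hst le_rfl (hg1.mono (Icc_subset_Icc_left hs)))
  rw [mildPath, mildPath, map_add, map_add, h2, ← h1, ← h3, ← h.flow hα hs hst ht]
  abel

theorem hasGen_mildPath (h : IsRoughConvolution C α T S X XX F F' L₀ I)
    (h' : IsRoughConvolution C' α T S X XX F F' L₁ I') (hL : GenComp S L₀ L₁) (hα : 1 / 3 < α)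
    (hx : S.HasGen x x') (hg : ContinuousOn g (Icc 0 T)) (hg' : ContinuousOn g' (Icc 0 T))
    (hgg' : ∀ r ∈ Icc 0 T, S.HasGen (g r) (g' r)) {t : ℝ} (ht : t ∈ Icc 0 T) :
    S.HasGen (mildPath S x g I t) (mildPath S x' g' I' t) := by
  have hsub : Icc 0 t ⊆ Icc 0 T := Icc_subset_Icc_right ht.2
  exact ((hx.op ht.1).add (C0Semigroup.HasGen.integral ht.1 (continuousOn_op_sub (hg.mono hsub))
    (continuousOn_op_sub (hg'.mono hsub))
    fun r hr => (hgg' r (hsub hr)).op (sub_nonneg.2 hr.2))).add (h.hasGen h' hL hα ht)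

/-- A path that follows the semigroup up to a Hölder error is continuous. To compare its values at
`t₀` and at a nearby `t`, both are propagated from a time `u` shortly before `t₀`. -/
theorem continuousOn_of_norm_sub_op_le {P : ℝ → W} {D : ℝ} (hα : 0 < α) (hD : 0 ≤ D)
    (h : ∀ s t, 0 ≤ s → s ≤ t → t ≤ T → ‖P t - S.op (t - s) (P s)‖ ≤ D * (t - s) ^ α) :
    ContinuousOn P (Icc 0 T) := by
  intro t₀ ht₀
  rw [ContinuousWithinAt, Metric.tendsto_nhds]
  intro ε hε
  have hη : Tendsto (fun η : ℝ => 2 * (D * (2 * η) ^ α)) (𝓝[>] 0) (𝓝 0) := by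
    have : ContinuousAt (fun η : ℝ => 2 * (D * (2 * η) ^ α)) 0 :=
      continuousAt_const.mul (continuousAt_const.mul
        ((continuousAt_const.mul continuousAt_id).rpow_const (Or.inr hα.le)))
    have h0 := this.tendsto
    rw [mul_zero, Real.zero_rpow hα.ne', mul_zero, mul_zero] at h0
    exact h0.mono_left nhdsWithin_le_nhds
  obtain ⟨η, hηε, hη0⟩ :=
    ((hη.eventually (eventually_lt_nhds (half_pos hε))).and self_mem_nhdsWithin).exists
  have hη0 : 0 < η := hη0
  set u : ℝ := max 0 (t₀ - η) with hu
  have hu0 : 0 ≤ u := le_max_left _ _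
  have hut₀ : u ≤ t₀ := max_le ht₀.1 (by linarith)
  have hu1 : t₀ - η ≤ u := le_max_right _ _
  have hev : ∀ᶠ t in 𝓝[Icc 0 T] t₀, t ∈ Icc 0 T ∧ t₀ - η < t ∧ t < t₀ + η := by
    filter_upwards [self_mem_nhdsWithin, mem_nhdsWithin_of_mem_nhds
      (Ioo_mem_nhds (show t₀ - η < t₀ by linarith) (show t₀ < t₀ + η by linarith))]
      with t h1 h2 using ⟨h1, h2.1, h2.2⟩
  have hS : Tendsto (fun t => S.op (t - u) (P u)) (𝓝[Icc 0 T] t₀) (𝓝 (S.op (t₀ - u) (P u))) := by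
    refine (S.continuousOn_op_apply (P u) (t₀ - u) (sub_nonneg.2 hut₀)).tendsto.comp
      (tendsto_nhdsWithin_iff.2 ⟨?_, ?_⟩)
    · exact ((continuous_sub_right u).tendsto t₀).mono_left nhdsWithin_le_nhds
    · filter_upwards [hev] with t ht
      exact sub_nonneg.2 (max_le ht.1.1 ht.2.1.le)
  filter_upwards [hev, (Metric.tendsto_nhds.1 hS) (ε / 2) (half_pos hε)] with t ht hts
  have hut : u ≤ t := max_le ht.1.1 ht.2.1.le
  have b : ∀ r, u ≤ r → r < t₀ + η → r ≤ T → ‖P r - S.op (r - u) (P u)‖ ≤ D * (2 * η) ^ α :=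
    fun r hr hr' hrT => (h u r hu0 hr hrT).trans (mul_le_mul_of_nonneg_left
      (Real.rpow_le_rpow (sub_nonneg.2 hr) (by linarith) hα.le) hD)
  have b1 := b t hut ht.2.2 ht.1.2
  have b2 := b t₀ hut₀ (by linarith) ht₀.2
  rw [dist_eq_norm] at hts ⊢
  calc ‖P t - P t₀‖ = ‖(P t - S.op (t - u) (P u)) +
        (S.op (t - u) (P u) - S.op (t₀ - u) (P u)) - (P t₀ - S.op (t₀ - u) (P u))‖ := by
        congr 1; abel
    _ ≤ ‖P t - S.op (t - u) (P u)‖ + ‖S.op (t - u) (P u) - S.op (t₀ - u) (P u)‖ +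
        ‖P t₀ - S.op (t₀ - u) (P u)‖ :=
        (norm_sub_le _ _).trans (add_le_add_left (norm_add_le _ _) _)
    _ < ε := by linarith

theorem continuousOn_mildPath (h : IsRoughConvolution C α T S X XX F F' L₀ I) (hα : 1 / 3 < α)
    (hα' : α ≤ 1 / 2) (hB : RoughBounds K α T X XX F F') (hg : ContinuousOn g (Icc 0 T)) :
    ContinuousOn (mildPath S x g I) (Icc 0 T) := by
  obtain ⟨D, hD, hDI⟩ := h.norm_sub_le hα hB
  obtain ⟨M, hM1, hM⟩ := S.exists_norm_op_le T
  obtain ⟨G, hG⟩ := isCompact_Icc.exists_bound_of_continuousOn hg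
  refine continuousOn_of_norm_sub_op_le (S := S) (α := α) (by linarith)
    (D := M * |G| * |T| ^ (1 - α) + D) (by positivity) fun s t hs hst ht => ?_
  have hts : 0 ≤ t - s := sub_nonneg.2 hst
  have hint : ‖∫ r in s..t, S.op (t - r) (g r)‖ ≤ M * |G| * |t - s| := by
    refine intervalIntegral.norm_integral_le_of_norm_le_const fun r hr => ?_
    rw [uIoc_of_le hst] at hr
    exact (S.op (t - r)).le_of_opNorm_le_of_le
      (hM _ ⟨sub_nonneg.2 hr.2, by linarith [hr.1]⟩)
      ((hG r ⟨hs.trans hr.1.le, hr.2.trans ht⟩).trans (le_abs_self G))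
  have hp : t - s ≤ |T| ^ (1 - α) * (t - s) ^ α := by
    have := rpow_le_mul_rpow hts (show t - s ≤ |T| by linarith [le_abs_self T])
      (show 0 < α by linarith) (show α ≤ 1 by linarith)
    rwa [Real.rpow_one] at this
  rw [abs_of_nonneg hts] at hint
  rw [mildPath_flow h hα hg hs hst ht, add_assoc, add_sub_cancel_left]
  calc _ ≤ M * |G| * (|T| ^ (1 - α) * (t - s) ^ α) + D * (t - s) ^ α :=
        (norm_add_le _ _).trans (add_le_add
          (hint.trans (mul_le_mul_of_nonneg_left hp (by positivity))) (hDI s t hs hst ht))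
    _ = _ := by ring

theorem hasDerivWithinAt_integral_Ici {k : ℝ → W} (hk : ContinuousOn k (Icc 0 T)) {u : ℝ}
    (hu : u ∈ Ico 0 T) :
    HasDerivWithinAt (fun v => ∫ r in (0 : ℝ)..v, k r) (k u) (Ici u) u := by
  have hmem : Icc 0 T ∈ 𝓝[>] u :=
    mem_of_superset (Ioc_mem_nhdsGT hu.2) fun v hv => ⟨hu.1.trans hv.1.le, hv.2⟩
  refine intervalIntegral.integral_hasDerivWithinAt_right (t := Ioi u) ?_ ?_ ?_
  · exact (hk.mono (by
      rw [uIcc_of_le hu.1]; exact Icc_subset_Icc_right hu.2.le)).intervalIntegrable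
  · exact ⟨Icc 0 T, hmem, hk.aestronglyMeasurable measurableSet_Icc⟩
  · exact (hk u (Ico_subset_Icc_self hu)).mono_of_mem_nhdsWithin hmem

/-- A mild path `P` with values in the domain of the generator `A`, for which `Q = A P` is
continuous, solves the integrated equation: the difference of the two sides has vanishing right
derivative everywhere. -/
theorem mildPath_eq_strong {C'' : ℝ} {J Q : ℝ → W}
    (h : IsRoughConvolution C α T S X XX F F' L₀ I)
    (hJ : IsSewing C'' (3 * α) T (roughGerm X XX F F' fun _ => L₀) J) (hL : GenComp S L₀ L₁)
    (hα : 1 / 3 < α) (hα' : α ≤ 1 / 2) (hB : RoughBounds K α T X XX F F')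
    (hg : ContinuousOn g (Icc 0 T)) (hg' : ContinuousOn g' (Icc 0 T))
    (hgg' : ∀ r ∈ Icc 0 T, S.HasGen (g r) (g' r)) (hQ : ContinuousOn Q (Icc 0 T))
    (hPQ : ∀ t ∈ Icc 0 T, S.HasGen (mildPath S x g I t) (Q t)) {t : ℝ} (ht : t ∈ Icc 0 T) :
    mildPath S x g I t = mildPath S x g I 0 + (∫ s in (0 : ℝ)..t, (Q s + g s)) + J t := by
  have hT : 0 ≤ T := ht.1.trans ht.2
  have hα0 : 0 < α := by linarith
  set P := mildPath S x g I with hP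
  have hPc : ContinuousOn P (Icc 0 T) := continuousOn_mildPath h hα hα' hB hg
  obtain ⟨D, hD⟩ := h.norm_sub_sub_le hJ hL hα hα' hB
  obtain ⟨M, hM1, hM⟩ := S.exists_norm_op_le T
  obtain ⟨G, hG⟩ := isCompact_Icc.exists_bound_of_continuousOn hg'
  have hii : ∀ {k : ℝ → W}, ContinuousOn k (Icc 0 T) → ∀ {a b : ℝ}, 0 ≤ a → a ≤ b → b ≤ T →
      IntervalIntegrable k volume a b := fun hk a b ha hab hb =>
    (hk.mono (by rw [uIcc_of_le hab]; exact Icc_subset_Icc ha hb)).intervalIntegrable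
  have hQg : ContinuousOn (fun s => Q s + g s) (Icc 0 T) := hQ.add hg
  have hJc : ContinuousOn J (Icc 0 T) := by
    obtain ⟨D', hD'⟩ : ∃ D', ∀ u v, 0 ≤ u → u ≤ v → v ≤ T → ‖J v - J u‖ ≤ D' * (v - u) ^ α := by
      refine ⟨|C''| * T ^ (3 * α - α) + ‖L₀‖ * K * K * (1 + T ^ α), fun u v hu huv hv => ?_⟩
      have hvu : 0 ≤ v - u := sub_nonneg.2 huv
      have h1 := hJ.le u v hu huv hv
      have h2 := hB.norm_roughGerm_le hα0 hu huv hv (L := fun _ => L₀) le_rfl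
      have h3 : C'' * (v - u) ^ (3 * α) ≤ |C''| * (T ^ (3 * α - α) * (v - u) ^ α) :=
        mul_le_mul (le_abs_self _) (rpow_le_mul_rpow hvu (by linarith) hα0 (by linarith))
          (Real.rpow_nonneg hvu _) (abs_nonneg _)
      calc ‖J v - J u‖ = ‖(J v - J u - roughGerm X XX F F' (fun _ => L₀) u v) +
            roughGerm X XX F F' (fun _ => L₀) u v‖ := by congr 1; abel
        _ ≤ _ := (norm_add_le _ _).trans (add_le_add (h1.trans h3) h2)
        _ = _ := by ring
    exact (isHolder_of_le hD').continuousOn hα0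
  have hIc : ContinuousOn (fun v => ∫ s in (0 : ℝ)..v, (Q s + g s)) (Icc 0 T) := by
    have := intervalIntegral.continuousOn_primitive_interval (μ := volume) (a := 0) (b := T)
      (f := fun s => Q s + g s) (by
        rw [uIcc_of_le hT]; exact hQg.integrableOn_Icc)
    rwa [uIcc_of_le hT] at this
  have key := constant_of_has_deriv_right_zero
    (f := fun v => P v - (∫ s in (0 : ℝ)..v, (Q s + g s)) - J v) ((hPc.sub hIc).sub hJc)
    (fun u hu => ?_) t ht
  · simp only [intervalIntegral.integral_same, hJ.zero, sub_zero] at key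
    rw [← key]; abel
  -- the part with a derivative is `S_{v-u} P_u - ∫₀ᵛ Q`; the rest is of order `3 α > 1`
  have hu' : u ∈ Icc 0 T := Ico_subset_Icc_self hu
  have hA : HasDerivWithinAt (fun v => S.op (v - u) (P u) - ∫ r in (0 : ℝ)..v, Q r)
      (Q u - Q u) (Ici u) u :=
    ((hPQ u hu').hasDerivWithinAt_sub u).sub (hasDerivWithinAt_integral_Ici hQ hu)
  have hR : HasDerivWithinAt (fun v => (P v - (∫ s in (0 : ℝ)..v, (Q s + g s)) - J v) -
      (S.op (v - u) (P u) - ∫ r in (0 : ℝ)..v, Q r)) 0 (Ici u) u := by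
    refine hasDerivWithinAt_zero_of_norm_sub_le (θ := 3 * α)
      (K := M * |G| * T ^ (2 - 3 * α) + D) (by linarith) hu.2 fun v hv => ?_
    have hvu : 0 ≤ v - u := sub_nonneg.2 hv.1
    have hv0 : 0 ≤ v := hu.1.trans hv.1
    have hflow : P v = S.op (v - u) (P u) + (∫ r in u..v, S.op (v - r) (g r)) +
        (I v v - I v u) := mildPath_flow h hα hg hu.1 hv.1 hv.2
    have hadd : ∀ w, 0 ≤ w → w ≤ T → (∫ s in (0 : ℝ)..w, (Q s + g s)) =
        (∫ s in (0 : ℝ)..w, Q s) + ∫ s in (0 : ℝ)..w, g s := fun w hw hwT =>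
      intervalIntegral.integral_add (hii hQ le_rfl hw hwT) (hii hg le_rfl hw hwT)
    have hsplit := intervalIntegral.integral_add_adjacent_intervals
      (hii hg le_rfl hu.1 hu'.2) (hii hg hu.1 hv.1 hv.2)
    have hdiff : (∫ r in u..v, S.op (v - r) (g r)) - ∫ r in u..v, g r =
        ∫ r in u..v, (S.op (v - r) (g r) - g r) :=
      (intervalIntegral.integral_sub (intervalIntegrable_op_sub hv.1 le_rfl
        (hg.mono (Icc_subset_Icc hu.1 hv.2))) (hii hg hu.1 hv.1 hv.2)).symm
    have hint : ‖∫ r in u..v, (S.op (v - r) (g r) - g r)‖ ≤ M * (v - u) * |G| * |v - u| := by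
      refine intervalIntegral.norm_integral_le_of_norm_le_const fun r hr => ?_
      rw [uIoc_of_le hv.1] at hr
      have hvr : 0 ≤ v - r := sub_nonneg.2 hr.2
      have hrT : r ∈ Icc 0 T := ⟨hu.1.trans hr.1.le, hr.2.trans hv.2⟩
      rw [C0Semigroup.hasGen_iff.1 (hgg' r hrT) _ hvr]
      refine (S.integralOp (v - r)).le_of_opNorm_le_of_le ((S.norm_integralOp_le
        ⟨hvr, by linarith [hv.2, hrT.1]⟩ hM).trans ?_) ((hG r hrT).trans (le_abs_self G))
      exact mul_le_mul_of_nonneg_left (by linarith [hr.1]) (by linarith)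
    have hp : (v - u) * (v - u) ≤ T ^ (2 - 3 * α) * (v - u) ^ (3 * α) := by
      have := rpow_le_mul_rpow (T := T) hvu (by linarith [hv.2, hu.1]) (show 0 < 3 * α by linarith)
        (show 3 * α ≤ 2 by linarith)
      rwa [Real.rpow_two, pow_two] at this
    have e : (P v - (∫ s in (0 : ℝ)..v, (Q s + g s)) - J v) -
        (S.op (v - u) (P u) - ∫ r in (0 : ℝ)..v, Q r) -
        ((P u - (∫ s in (0 : ℝ)..u, (Q s + g s)) - J u) -
        (S.op (u - u) (P u) - ∫ r in (0 : ℝ)..u, Q r)) =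
        (∫ r in u..v, (S.op (v - r) (g r) - g r)) + (I v v - I v u - (J v - J u)) := by
      rw [hflow, hadd v hv0 hv.2, hadd u hu.1 hu'.2, ← hsplit, ← hdiff, sub_self, S.op_zero,
        ContinuousLinearMap.id_apply]
      abel
    rw [e]
    rw [abs_of_nonneg hvu] at hint
    calc _ ≤ M * (v - u) * |G| * (v - u) + D * (v - u) ^ (3 * α) :=
          (norm_add_le _ _).trans (add_le_add hint (hD u v hu.1 hv.1 hv.2))
      _ = M * |G| * ((v - u) * (v - u)) + D * (v - u) ^ (3 * α) := by ring
      _ ≤ M * |G| * (T ^ (2 - 3 * α) * (v - u) ^ (3 * α)) + D * (v - u) ^ (3 * α) := by gcongr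
      _ = _ := by ring
  have hsum := hA.add hR
  rw [sub_self, add_zero] at hsum
  refine hsum.congr_of_mem (fun v _ => ?_) self_mem_Ici
  simp only [Pi.add_apply]
  abel

end Convolution

/-! ### The domains of the generator -/

section DomainMaps

variable {W : Type*} [NormedAddCommGroup W] [NormedSpace ℝ W]

/-- The generator as a bounded operator `D(A) → W`. -/
noncomputable def Dom.appL (A : W →ₗ.[ℝ] W) : Dom A →L[ℝ] W :=
  (Dom.app A).mkContinuous 1 fun y => by
    rw [Dom.norm_def]; linarith [norm_nonneg (Dom.val A y)]

/-- The generator as a bounded operator `D(A²) → W`. -/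
noncomputable def Dom2.appL (A : W →ₗ.[ℝ] W) : Dom2 A →L[ℝ] W :=
  (Dom.app A ∘ₗ Dom2.toDom A).mkContinuous 1 fun y => by
    rw [Dom2.norm_def, LinearMap.comp_apply]
    linarith [norm_nonneg (Dom.val A (Dom2.toDom A y)), norm_nonneg (Dom.app A (Dom2.app A y))]

/-- The square of the generator as a bounded operator `D(A²) → W`. -/
noncomputable def Dom2.appSqL (A : W →ₗ.[ℝ] W) : Dom2 A →L[ℝ] W :=
  (Dom.app A ∘ₗ Dom2.app A).mkContinuous 1 fun y => by
    rw [Dom2.norm_def, LinearMap.comp_apply]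
    linarith [norm_nonneg (Dom.val A (Dom2.toDom A y)), norm_nonneg (Dom.app A (Dom2.toDom A y))]

theorem C0Semigroup.hasGen_of_mem_domain {S : C0Semigroup W} {y : W}
    (hy : y ∈ S.generator.domain) : S.HasGen y (S.gen y) := by
  obtain ⟨z, hz⟩ := hy
  rwa [hz.gen_eq]

theorem Dom.hasGen (S : C0Semigroup W) (y : Dom S.generator) :
    S.HasGen (Dom.val S.generator y) (Dom.app S.generator y) :=
  C0Semigroup.hasGen_of_mem_domain y.2

theorem Dom2.genComp_incl (S : C0Semigroup W) :
    GenComp S (Dom2.incl S.generator) (Dom2.appL S.generator) := fun y =>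
  Dom.hasGen S (Dom2.toDom S.generator y)

theorem Dom2.genComp_appL (S : C0Semigroup W) :
    GenComp S (Dom2.appL S.generator) (Dom2.appSqL S.generator) := fun y =>
  Dom.hasGen S (Dom2.app S.generator y)

end DomainMaps

end RoughPDE

/-! ### Mild solutions are strong solutions -/

open RoughPDE in
theorem mainTheorem4
    {V W : Type*} [NormedAddCommGroup V] [NormedSpace ℝ V] [CompleteSpace V]
    [NormedAddCommGroup W] [NormedSpace ℝ W] [CompleteSpace W]
    (S : RoughPDE.C0Semigroup W)
    (α T : ℝ) (hα : 1 / 3 < α) (hα' : α ≤ 1 / 2)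
    (X : ℝ → V) (XX : ℝ → ℝ → RoughPDE.ProjTensor V)
    (hX : RoughPDE.IsRoughPath α T X XX)
    (f₀ : ℝ → W → RoughPDE.Dom S.generator) (hf₀ : RoughPDE.IsLip T f₀)
    (f : ℝ → W → V →L[ℝ] RoughPDE.Dom2 S.generator)
    (hf : RoughPDE.IsCb (2 * α) 2 T f)
    (ξ : W) (hξ : ξ ∈ S.generator.domain)
    (T₀ : ℝ) (hT₀ : 0 < T₀) (hT₀T : T₀ ≤ T)
    (Y : ℝ → W) (Y' : ℝ → V →L[ℝ] W)
    (hY : RoughPDE.IsLocalMildSolution S α T₀ X XX f₀ f ξ Y Y')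
    (hAY : ∃ K : ℝ, ∀ t ∈ Set.Icc 0 T₀, ‖S.gen (Y t)‖ ≤ K) :
    RoughPDE.IsLocalStrongSolution S α T₀ X XX
      (fun t y => RoughPDE.Dom.incl S.generator (f₀ t y))
      (fun t y => (RoughPDE.Dom2.incl S.generator).comp (f t y)) ξ Y Y' := by
  have hα0 : 0 < α := by linarith
  have hsub : Icc 0 T₀ ⊆ Icc 0 T := Icc_subset_Icc_right hT₀T
  have hX₀ := hX.mono hT₀T
  obtain ⟨K, hB⟩ := (hf.isControlled_comp hα0 hT₀T hY.controlled).exists_roughBounds hX₀ hα0.le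
  obtain ⟨C, -, I, hI⟩ := hB.exists_isRoughConvolution hX₀ hα hα' (Dom2.genComp_incl S)
  obtain ⟨C', -, I', hI'⟩ := hB.exists_isRoughConvolution hX₀ hα hα' (Dom2.genComp_appL S)
  obtain ⟨C'', -, hJ⟩ := hB.exists_isSewing (W := W) hX₀ hα hα'
    (norm_nonneg (Dom2.incl S.generator)) le_rfl
  obtain ⟨J, hJ⟩ := hJ T₀ le_rfl (fun _ => Dom2.incl S.generator) (fun _ _ _ => le_rfl)
    (fun _ _ _ _ _ => by simp)
  -- `r ↦ f₀(r, Y_r)` is continuous for the graph norm, so both it and its image under `A` are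
  -- continuous in `W`
  have hfY : ContinuousOn (fun r => f₀ r (Y r)) (Icc 0 T₀) :=
    hf₀.1.comp (continuousOn_id.prodMk (hY.controlled.holder.continuousOn hα0))
      fun r hr => ⟨hsub hr, mem_univ _⟩
  have hg := (Dom.incl S.generator).continuous.comp_continuousOn hfY
  have hg' := (Dom.appL S.generator).continuous.comp_continuousOn hfY
  have hgg' : ∀ r ∈ Icc 0 T₀, S.HasGen ((Dom.incl S.generator ∘ fun r => f₀ r (Y r)) r)
      ((Dom.appL S.generator ∘ fun r => f₀ r (Y r)) r) := fun r _ => Dom.hasGen S (f₀ r (Y r))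
  set g : ℝ → W := Dom.incl S.generator ∘ fun r => f₀ r (Y r) with hgdef
  set g' : ℝ → W := Dom.appL S.generator ∘ fun r => f₀ r (Y r)
  -- uniqueness of the limit identifies `roughIntegral` with the rough convolution `I t t`
  have hYP : ∀ t ∈ Icc 0 T₀, Y t = mildPath S ξ g I t := by
    intro t ht
    rw [hY.equation t ht, ((hI t ht.2).hasRoughIntegral (by linarith) le_rfl).roughIntegral_eq ht.1]
    rfl
  have hgen : ∀ t ∈ Icc 0 T₀,
      S.HasGen (mildPath S ξ g I t) (mildPath S (S.gen ξ) g' I' t) := fun t ht =>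
    hasGen_mildPath hI hI' (Dom2.genComp_incl S) hα (C0Semigroup.hasGen_of_mem_domain hξ) hg hg'
      hgg' ht
  have hAYQ : ∀ t ∈ Icc 0 T₀, S.gen (Y t) = mildPath S (S.gen ξ) g' I' t := fun t ht => by
    rw [hYP t ht, (hgen t ht).gen_eq]
  have hQ : ContinuousOn (mildPath S (S.gen ξ) g' I') (Icc 0 T₀) :=
    continuousOn_mildPath hI' hα hα' hB hg'
  have h0 : mildPath S ξ g I 0 = ξ := by
    simp [mildPath, S.op_zero, (hI 0 hT₀.le).zero]
  refine ⟨hY.controlled, fun t ht => ?_, hAY, hY.deriv_eq, fun t ht => ?_,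
    fun t ht => ⟨J t, ?_, ?_⟩⟩
  · rw [hYP t ht]
    exact ⟨_, hgen t ht⟩
  · have hc : ContinuousOn (fun s => S.gen (Y s) + g s) (Icc 0 T₀) :=
      (hQ.add hg).congr fun s hs => by rw [hAYQ s hs]; rfl
    exact (hc.mono (by
      rw [uIcc_of_le ht.1]; exact Icc_subset_Icc_right ht.2)).intervalIntegrable
  · -- off `[0,T]` the derivatives of `f` may be junk, but partitions of `[0,t]` never see them
    refine (hJ.hasRoughIntegral (by linarith) ht.2).congr (fun _ _ => rfl) fun s hs => ?_
    exact (hf.compDeriv_clm_comp two_ne_zero _ ⟨hs.1, hs.2.trans (ht.2.trans hT₀T)⟩).symm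
  · rw [hYP t ht, mildPath_eq_strong hI hJ (Dom2.genComp_incl S) hα hα' hB hg hg' hgg' hQ hgen ht,
      h0]
    congr 2
    refine intervalIntegral.integral_congr fun s hs => ?_
    rw [uIcc_of_le ht.1] at hs
    change mildPath S (S.gen ξ) g' I' s + g s = S.gen (Y s) + g s
    rw [hAYQ s ⟨hs.1, hs.2.trans ht.2⟩]
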